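/- Let $\Bbbk$ be a field and let $(V,c)$ be a finite-dimensional rigid braided vector space with basis $x_1,\dots,x_n$; that is, $c\in\mathrm{Aut}(V\otimes V)$ satisfies the braid equation $(c\otimes\mathrm{id})(\mathrm{id}\otimes c)(c\otimes\mathrm{id})=(\mathrm{id}\otimes c)(c\otimes\mathrm{id})(\mathrm{id}\otimes c)$, and the map $c^\flat:V^*\otimes V\to V\otimes V^*$, $f\otimes x\mapsto\sum_i(\mathrm{ev}\otimes\mathrm{id}\otimes\mathrm{id})(f\otimes c(x\otimes x_i)\otimes x_i^*)$, is bijective. Write $c(x_i\otimes x_j)=\sum_{k,\ell}c_{ij}^{k\ell}\,x_k\otimes x_\ell$. Let $A(c)$ be the algebra generated by $t_i^j$ $(1\le i,j\le n)$ with relations $\sum_{k,\ell}c_{ij}^{k\ell}t_k^rt_\ell^s=\sum_{k,\ell}t_i^kt_j^\ell c_{k\ell}^{rs}$. It is a bialgebra with $\Delta(t_i^j)=\sum_k t_i^k\otimes t_k^j$, $\varepsilon(t_i^j)=\delta_i^j$, it coacts on $V$ by $\lambda(x_i)=\sum_j t_i^j\otimes x_j$, and it is coquasitriangular for the bilinear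 form $r$ determined by $r(t_i^k,t_j^\ell)=c_{ji}^{k\ell}$, $r(ab,d)=r(a,d_{(1)})r(b,d_{(2)})$ and $r(a,bd)=r(a_{(2)},b)r(a_{(1)},d)$. (A bialgebra is coquasitriangular if it has a convolution-invertible bilinear form $r$ satisfying the last two identities and $r(a_{(1)},b_{(1)})a_{(2)}b_{(2)}=b_{(1)}a_{(1)}r(a_{(2)},b_{(2)})$.) Let $\mathfrak B=\bigoplus_{m\ge0}\mathfrak B^m$ be a weakly graded-Frobenius algebra for $A(c)$ and $V$: a finite-dimensional $\mathbb N$-graded left $A(c)$-comodule algebra whose coaction $\lambda$ preserves the grading, with $\mathfrak B^0=\Bbbk$, $\mathfrak B^1=V$ as comodules, $\dim\mathfrak B^{top}=1$ for $top=\max\{m:\mathfrak B^m\ne0\}$, and such that the multiplications $\mathfrak B^1\times\mathfrak B^{top-1}\to\mathfrak B^{top}$ and $\mathfrak B^{top-1}\times\mathfrak B^1\to\mathfrak B^{top}$ are non-degenerate (with $\mathfrak B^{-1}=0$). Let $0\ne\mathfrak b\in\mathfrak B^{top}$, let $D\in A(c)$ be the group-like element with $\lambda(\mathfrak b)=D\otimes\mathfrak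 b$ (the quantum determinant), let $\omega^1,\dots,\omega^n$ be the basis of $\mathfrak B^{top-1}$ with $x_i\omega^j=\delta_i^j\,\mathfrak b$, and define $T_j^i\in A(c)$ by $\lambda(\omega^i)=\sum_j T_j^i\otimes\omega^j$. Let $\mathfrak J:A(c)\to A(c)$, $\mathfrak J(a)=r(a_{(1)},D)\,a_{(2)}\,r^{-1}(a_{(3)},D)$, where $r^{-1}$ is the convolution inverse of $r$, be Hayashi's automorphism attached to $D$ (it satisfies $Da=\mathfrak J(a)D$). Finally, let $H(c)=A(c)[D^{-1}]$ be the algebra generated by the $t_i^j$ and $D^{-1}$ with the relations of $A(c)$ and $DD^{-1}=1=D^{-1}D$, with the bialgebra structure that extends that of $A(c)$ by $\Delta(D^{-1})=D^{-1}\otimes D^{-1}$, $\varepsilon(D^{-1})=1$. **Theorem.** Assume that in $A(c)$ $$\sum_{k=1}^n\mathfrak J(T_i^k)\,t_k^j=\delta_i^j\,D\qquad\text{for all }1\le i,j\le n.$$ Then $H(c)$ is a coquasitriangular Hopf algebra, and its antipode satisfies $\mathcal S(D^{-1})=D$ and $\mathcal S(t_i^j)=T_i^jD^{-1}$ for all $1\le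 i,j\le n$ (the elements of $A(c)$ being replaced by their images in $H(c)$). -/

import Mathlib

open scoped TensorProduct

noncomputable section

namespace QDet

universe u v w

/-! ## Braided vector spaces -/

section Braided

variable {k : Type u} {V : Type v} [Field k] [AddCommGroup V] [Module k V]

/-- The operator `c ⊗ id` on `V ⊗ V ⊗ V`. -/
def braid12 (c : V ⊗[k] V ≃ₗ[k] V ⊗[k] V) : V ⊗[k] (V ⊗[k] V) →ₗ[k] V ⊗[k] (V ⊗[k] V) :=
  (TensorProduct.assoc k V V V).toLinearMap ∘ₗ c.toLinearMap.rTensor V ∘ₗ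
    (TensorProduct.assoc k V V V).symm.toLinearMap

/-- The operator `id ⊗ c` on `V ⊗ V ⊗ V`. -/
def braid23 (c : V ⊗[k] V ≃ₗ[k] V ⊗[k] V) : V ⊗[k] (V ⊗[k] V) →ₗ[k] V ⊗[k] (V ⊗[k] V) :=
  c.toLinearMap.lTensor V

/-- `(V, c)` is a braided vector space: the automorphism `c` of `V ⊗ V` satisfies the braid
equation. -/
def IsBraiding (c : V ⊗[k] V ≃ₗ[k] V ⊗[k] V) : Prop :=
  braid12 c ∘ₗ braid23 c ∘ₗ braid12 c = braid23 c ∘ₗ braid12 c ∘ₗ braid23 c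

variable {ι : Type w} [Fintype ι]

/-- The map `c♭ : V* ⊗ V → V ⊗ V*`, `f ⊗ y ↦ ∑ i, (ev ⊗ id ⊗ id) (f ⊗ c (y ⊗ xᵢ) ⊗ xᵢ*)`. -/
def flat (x : Module.Basis ι k V) (c : V ⊗[k] V ≃ₗ[k] V ⊗[k] V) :
    Module.Dual k V ⊗[k] V →ₗ[k] V ⊗[k] Module.Dual k V :=
  TensorProduct.lift (LinearMap.mk₂ k
    (fun f y => ∑ i, TensorProduct.lid k V (LinearMap.rTensor V f (c (y ⊗ₜ[k] x i))) ⊗ₜ[k] x.coord i)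
    (fun f g y => by
      simp [LinearMap.rTensor_add, TensorProduct.add_tmul, Finset.sum_add_distrib])
    (fun a f y => by
      simp [LinearMap.rTensor_smul, TensorProduct.smul_tmul', Finset.smul_sum])
    (fun f y z => by
      simp [TensorProduct.add_tmul, Finset.sum_add_distrib])
    (fun a f y => by
      simp [← TensorProduct.smul_tmul', Finset.smul_sum]))

/-- The braiding `c` is rigid. -/
def IsRigid (x : Module.Basis ι k V) (c : V ⊗[k] V ≃ₗ[k] V ⊗[k] V) : Prop :=
  Function.Bijective (flat x c)

/-- The coefficients `c i j p q` in `c (xᵢ ⊗ xⱼ) = ∑ p q, (c i j p q) xₚ ⊗ x_q`. -/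
def braidCoeff (x : Module.Basis ι k V) (c : V ⊗[k] V ≃ₗ[k] V ⊗[k] V) (i j p q : ι) : k :=
  (x.tensorProduct x).repr (c (x i ⊗ₜ[k] x j)) (p, q)

theorem braid_basis (x : Module.Basis ι k V) (c : V ⊗[k] V ≃ₗ[k] V ⊗[k] V) (i j : ι) :
    c (x i ⊗ₜ[k] x j) = ∑ p, ∑ q, braidCoeff x c i j p q • (x p ⊗ₜ[k] x q) := by
  rw [← Fintype.sum_prod_type' (f := fun p q => braidCoeff x c i j p q • (x p ⊗ₜ[k] x q))]
  conv_lhs => rw [← (x.tensorProduct x).sum_repr (c (x i ⊗ₜ[k] x j))]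
  simp [braidCoeff, Module.Basis.tensorProduct_apply']

/-- The braid equation for a family of coefficients. -/
def BraidEq (C : ι → ι → ι → ι → k) : Prop :=
  ∀ a i j p q s : ι,
    ∑ n, ∑ m, ∑ l, C a i n m * C m j l s * C n l p q =
      ∑ n, ∑ l, ∑ m, C i j n l * C a n p m * C m l q s

theorem IsBraiding.coeff {x : Module.Basis ι k V} {c : V ⊗[k] V ≃ₗ[k] V ⊗[k] V}
    (h : IsBraiding c) : BraidEq (braidCoeff x c) := by
  classical
  intro a i j p q s
  have h1 := LinearMap.congr_fun h (x a ⊗ₜ[k] (x i ⊗ₜ[k] x j))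
  simp only [braid12, braid23, LinearMap.comp_apply, LinearEquiv.coe_coe, LinearMap.lTensor_tmul,
    LinearMap.rTensor_tmul, TensorProduct.assoc_symm_tmul, TensorProduct.assoc_tmul, braid_basis,
    map_sum, map_smul, TensorProduct.tmul_sum, TensorProduct.sum_tmul, TensorProduct.tmul_smul,
    ← TensorProduct.smul_tmul', smul_smul, Finset.smul_sum] at h1
  have h2 := congrArg (fun z => (x.tensorProduct (x.tensorProduct x)).repr z (p, (q, s))) h1
  simp only [map_sum, map_smul, Finsupp.coe_finsetSum, Finset.sum_apply, Finsupp.smul_apply,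
    Module.Basis.tensorProduct_repr_tmul_apply, Module.Basis.repr_self, smul_eq_mul,
    Finsupp.single_apply] at h2
  simpa using h2

end Braided

/-! ## The FRT bialgebra -/

section FRT

variable {k : Type u} {ι : Type w} [Field k] [Fintype ι]

/-- The relations `∑ p q, (C i j p q) tₚʳ t_qˢ = ∑ p q, tᵢᵖ tⱼ^q (C p q r s)`; the free generator
with index `(i, j)` is `tᵢʲ`. -/
inductive FRTRel (C : ι → ι → ι → ι → k) :
    FreeAlgebra k (ι × ι) → FreeAlgebra k (ι × ι) → Prop
  | frt (i j r s : ι) : FRTRel C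
      (∑ p, ∑ q, C i j p q • (FreeAlgebra.ι k (p, r) * FreeAlgebra.ι k (q, s)))
      (∑ p, ∑ q, C p q r s • (FreeAlgebra.ι k (i, p) * FreeAlgebra.ι k (j, q)))

/-- The FRT construction: the algebra with generators `tᵢʲ` and relations `FRTRel`. -/
def FRT (C : ι → ι → ι → ι → k) : Type (max u w) := RingQuot (FRTRel C)

namespace FRT

theorem sum_comm₄ {M : Type*} [AddCommMonoid M] (f : ι → ι → ι → ι → M) :
    ∑ p, ∑ q, ∑ m, ∑ n, f p q m n = ∑ m, ∑ n, ∑ p, ∑ q, f p q m n := by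
  simp only [← Fintype.sum_prod_type' (f := fun m n => f _ _ m n)]
  rw [← Fintype.sum_prod_type' (f := fun p q => ∑ x : ι × ι, f p q x.1 x.2), Finset.sum_comm]
  simp only [Fintype.sum_prod_type]

variable (C : ι → ι → ι → ι → k)

instance : Ring (FRT C) := inferInstanceAs (Ring (RingQuot (FRTRel C)))

instance : Algebra k (FRT C) := inferInstanceAs (Algebra k (RingQuot (FRTRel C)))

/-- The quotient map from the free algebra. -/
def mk : FreeAlgebra k (ι × ι) →ₐ[k] FRT C := RingQuot.mkAlgHom k (FRTRel C)

/-- The generator `tᵢʲ`. -/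
def t (i j : ι) : FRT C := mk C (FreeAlgebra.ι k (i, j))

theorem mk_surjective : Function.Surjective (mk C) := RingQuot.mkAlgHom_surjective k (FRTRel C)

theorem rel (i j r s : ι) :
    ∑ p, ∑ q, C i j p q • (t C p r * t C q s) = ∑ p, ∑ q, C p q r s • (t C i p * t C j q) := by
  have h : mk C _ = mk C _ := RingQuot.mkAlgHom_rel k (FRTRel.frt (C := C) i j r s)
  simp only [map_sum, map_smul, map_mul] at h
  exact h

variable {C} in
theorem hom_ext {B : Type*} [Semiring B] [Algebra k B] {f g : FRT C →ₐ[k] B}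
    (h : ∀ i j, f (t C i j) = g (t C i j)) : f = g := by
  apply RingQuot.ringQuot_ext' k
  apply FreeAlgebra.hom_ext
  funext ij
  exact h ij.1 ij.2

/-- The algebra map defined by the images of the generators. -/
def lift {B : Type*} [Semiring B] [Algebra k B] (f : ι → ι → B)
    (h : ∀ i j r s, ∑ p, ∑ q, C i j p q • (f p r * f q s) =
      ∑ p, ∑ q, C p q r s • (f i p * f j q)) : FRT C →ₐ[k] B :=
  RingQuot.liftAlgHom k ⟨FreeAlgebra.lift k fun ij => f ij.1 ij.2, by
    rintro _ _ ⟨i, j, r, s⟩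
    simpa only [map_sum, map_smul, map_mul, FreeAlgebra.lift_ι_apply] using h i j r s⟩

@[simp]
theorem lift_t {B : Type*} [Semiring B] [Algebra k B] (f : ι → ι → B)
    (h : ∀ i j r s, ∑ p, ∑ q, C i j p q • (f p r * f q s) =
      ∑ p, ∑ q, C p q r s • (f i p * f j q)) (i j : ι) : lift C f h (t C i j) = f i j := by
  have h1 := RingQuot.liftAlgHom_mkAlgHom_apply k (FreeAlgebra.lift k fun ij : ι × ι => f ij.1 ij.2)
    (s := FRTRel C) (by
      rintro _ _ ⟨i, j, r, s⟩
      simpa only [map_sum, map_smul, map_mul, FreeAlgebra.lift_ι_apply] using h i j r s)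
    (FreeAlgebra.ι k (i, j))
  rw [FreeAlgebra.lift_ι_apply] at h1
  exact h1

variable [DecidableEq ι]

/-- The comultiplication, `tᵢʲ ↦ ∑ m, tᵢᵐ ⊗ tₘʲ`. -/
def comulHom : FRT C →ₐ[k] FRT C ⊗[k] FRT C :=
  lift C (fun i j => ∑ m, t C i m ⊗ₜ[k] t C m j) (by
    intro i j r s
    have key : ∀ a b c d : ι, (∑ m, t C a m ⊗ₜ[k] t C m b) * (∑ m, t C c m ⊗ₜ[k] t C m d) =
        ∑ m, ∑ n, (t C a m * t C c n) ⊗ₜ[k] (t C m b * t C n d) := by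
      intro a b c d
      simp [Finset.sum_mul_sum]
    simp only [key]
    calc ∑ p, ∑ q, C i j p q • ∑ m, ∑ n, (t C p m * t C q n) ⊗ₜ[k] (t C m r * t C n s)
        = ∑ m, ∑ n, (∑ p, ∑ q, C i j p q • (t C p m * t C q n)) ⊗ₜ[k] (t C m r * t C n s) := by
          simp only [TensorProduct.sum_tmul, ← TensorProduct.smul_tmul', Finset.smul_sum]
          exact sum_comm₄ _
      _ = ∑ m, ∑ n, (∑ p, ∑ q, C p q m n • (t C i p * t C j q)) ⊗ₜ[k] (t C m r * t C n s) := by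
          simp only [rel]
      _ = ∑ p, ∑ q, (t C i p * t C j q) ⊗ₜ[k]
            (∑ m, ∑ n, C p q m n • (t C m r * t C n s)) := by
          simp only [TensorProduct.sum_tmul, TensorProduct.tmul_sum, ← TensorProduct.smul_tmul',
            TensorProduct.tmul_smul]
          exact sum_comm₄ _
      _ = ∑ p, ∑ q, (t C i p * t C j q) ⊗ₜ[k]
            (∑ m, ∑ n, C m n r s • (t C p m * t C q n)) := by
          simp only [rel]
      _ = _ := by
          simp only [TensorProduct.tmul_sum, TensorProduct.tmul_smul, Finset.smul_sum]
          exact sum_comm₄ _)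

/-- The counit, `tᵢʲ ↦ δᵢʲ`. -/
def counitHom : FRT C →ₐ[k] k :=
  lift C (fun i j => if i = j then 1 else 0) (by
    intro i j r s
    simp [Finset.sum_ite_eq, Finset.sum_ite_eq'])

instance instBialgebra : Bialgebra k (FRT C) :=
  Bialgebra.ofAlgHom (comulHom C) (counitHom C)
    (by
      apply hom_ext
      intro i j
      simp only [comulHom, AlgHom.comp_apply, lift_t, map_sum, Algebra.TensorProduct.map_tmul,
        TensorProduct.sum_tmul, TensorProduct.tmul_sum, AlgHom.id_apply]
      rw [Finset.sum_comm]
      simp)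
    (by
      apply hom_ext
      intro i j
      simp [comulHom, counitHom, TensorProduct.ite_tmul])
    (by
      apply hom_ext
      intro i j
      simp [comulHom, counitHom, TensorProduct.tmul_ite])

@[simp]
theorem comul_t (i j : ι) :
    Coalgebra.comul (R := k) (t C i j) = ∑ m, t C i m ⊗ₜ[k] t C m j :=
  lift_t C _ _ i j

@[simp]
theorem counit_t (i j : ι) :
    Coalgebra.counit (R := k) (t C i j) = if i = j then 1 else 0 :=
  lift_t C _ _ i j

end FRT

end FRT

/-! ## Coquasitriangular bialgebras and Hayashi's map -/

section CQT

open WithConv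

variable {k : Type u} {A : Type v} [Field k] [Ring A] [Bialgebra k A]

/-- The bilinear form `r` is a coquasitriangular structure on the bialgebra `A`. Invertibility and
the products in the last condition refer to the convolution product: the last condition reads
`r(a₁, b₁) a₂ b₂ = b₁ a₁ r(a₂, b₂)` in Sweedler's notation. -/
structure IsCoquasitriangular (r : A →ₗ[k] A →ₗ[k] k) : Prop where
  isUnit : IsUnit (toConv (TensorProduct.lift r))
  /-- `r(ab, d) = r(a, d₁) r(b, d₂)` -/
  mul_left (a b d : A) : r (a * b) d =
    LinearMap.mul' k k (TensorProduct.map (r a) (r b) (Coalgebra.comul d))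
  /-- `r(a, bd) = r(a₂, b) r(a₁, d)` -/
  mul_right (a b d : A) : r a (b * d) =
    LinearMap.mul' k k (TensorProduct.map (r.flip d) (r.flip b) (Coalgebra.comul a))
  comm : toConv (Algebra.linearMap k A ∘ₗ TensorProduct.lift r) * toConv (LinearMap.mul' k A) =
    toConv (LinearMap.mul' k A ∘ₗ (TensorProduct.comm k A A).toLinearMap) *
      toConv (Algebra.linearMap k A ∘ₗ TensorProduct.lift r)

/-- The convolution inverse `r⁻¹` of a (convolution-invertible) bilinear form `r`. -/
def convInv (r : A →ₗ[k] A →ₗ[k] k) : A →ₗ[k] A →ₗ[k] k :=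
  TensorProduct.curry (Ring.inverse (toConv (TensorProduct.lift r))).ofConv

/-- Hayashi's map `𝔍_g`, `a ↦ r(a₁, g) a₂ r⁻¹(a₃, g)`. -/
def hayashi (r : A →ₗ[k] A →ₗ[k] k) (g : A) : A →ₗ[k] A :=
  (TensorProduct.lid k A).toLinearMap ∘ₗ
    TensorProduct.map (r.flip g)
      ((TensorProduct.rid k A).toLinearMap ∘ₗ ((convInv r).flip g).lTensor A) ∘ₗ
    (Coalgebra.comul (R := k) (A := A)).lTensor A ∘ₗ Coalgebra.comul

end CQT

/-! ## The coquasitriangular structure of the FRT bialgebra -/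

namespace FRT

open WithConv

variable {k : Type u} {ι : Type w} [Field k] [Fintype ι] [DecidableEq ι]
  {C : ι → ι → ι → ι → k}

/-- The matrix representation of `FRT C` whose entry `(p, i)` is `r(tᵢᵖ, -)`. -/
def rho (hC : BraidEq C) : FRT C →ₐ[k] Matrix ι ι k :=
  lift C (fun j l => Matrix.of fun p i => C j i p l) (by
    intro i j r s
    ext q p
    have h := hC i j p q r s
    simp only [Matrix.sum_apply, Matrix.smul_apply, Matrix.mul_apply, Matrix.of_apply,
      smul_eq_mul, Finset.mul_sum]
    calc ∑ x, ∑ y, ∑ z, C i j x y * (C x z q r * C y p z s)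
        = ∑ x, ∑ y, ∑ z, C i j x z * C z p y s * C x y q r := by
          refine Finset.sum_congr rfl fun x _ => ?_
          rw [Finset.sum_comm]
          refine Finset.sum_congr rfl fun y _ => Finset.sum_congr rfl fun z _ => by ring
      _ = ∑ n, ∑ l, ∑ m, C j p n l * C i n q m * C m l r s := by
          rw [← h]
          refine Finset.sum_congr rfl fun x _ => ?_
          rw [Finset.sum_comm]
      _ = ∑ x, ∑ y, ∑ z, C x y r s * (C i z q x * C j p z y) := by
          rw [Finset.sum_congr rfl fun n _ => Finset.sum_comm, Finset.sum_comm,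
            Finset.sum_congr rfl fun l _ => Finset.sum_comm]
          refine Finset.sum_congr rfl fun x _ => Finset.sum_congr rfl fun y _ =>
            Finset.sum_congr rfl fun z _ => by ring)

/-- The linear form `r(tᵢᵖ, -)`. -/
def tForm (hC : BraidEq C) (i p : ι) : FRT C →ₗ[k] k :=
  Matrix.entryLinearMap k k p i ∘ₗ (rho hC).toLinearMap

theorem tForm_apply (hC : BraidEq C) (i p : ι) (b : FRT C) : tForm hC i p b = rho hC b p i := rfl

/-- The Kronecker square of `rho`, as a representation of `FRT C ⊗ FRT C`. -/
def rhoKron (hC : BraidEq C) : FRT C ⊗[k] FRT C →ₐ[k] Matrix (ι × ι) (ι × ι) k :=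
  (Matrix.kroneckerAlgEquiv ι ι k).toAlgHom.comp (Algebra.TensorProduct.map (rho hC) (rho hC))

theorem rhoKron_tmul (hC : BraidEq C) (a b : FRT C) (p q i j : ι) :
    rhoKron hC (a ⊗ₜ[k] b) (p, q) (i, j) = rho hC a p i * rho hC b q j := by
  simp [rhoKron]

theorem tForm_conv (hC : BraidEq C) (i p j q : ι) (b : FRT C) :
    (toConv (tForm hC i p) * toConv (tForm hC j q)).ofConv b =
      rhoKron hC (Coalgebra.comul b) (p, q) (i, j) := by
  rw [LinearMap.convMul_apply]
  induction (Coalgebra.comul (R := k) b) using TensorProduct.induction_on with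
  | zero => simp
  | tmul x y => simp [rhoKron_tmul, tForm_apply]
  | add x y hx hy => simp [map_add, hx, hy]

theorem rhoKron_comm (hC : BraidEq C) (b : FRT C) :
    rhoKron hC (Coalgebra.comul b) ∈
      Subalgebra.centralizer k {(Matrix.of fun x y => C y.1 y.2 x.1 x.2 :
        Matrix (ι × ι) (ι × ι) k)} := by
  obtain ⟨b, rfl⟩ := mk_surjective C b
  induction b using FreeAlgebra.induction with
  | grade0 a =>
    rw [AlgHom.commutes, Bialgebra.comul_algebraMap, AlgHom.commutes]
    exact Subalgebra.algebraMap_mem _ a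
  | grade1 x =>
    obtain ⟨a, b⟩ := x
    rw [show mk C (FreeAlgebra.ι k (a, b)) = t C a b from rfl, comul_t,
      Subalgebra.mem_centralizer_iff]
    rintro _ rfl
    ext ⟨r, s⟩ ⟨i, j⟩
    have h := hC a i j r s b
    simp only [map_sum, Matrix.mul_apply, Matrix.sum_apply, rhoKron_tmul, rho, lift_t,
      Matrix.of_apply, Fintype.sum_prod_type]
    calc ∑ n, ∑ l, C n l r s * ∑ m, C a i n m * C m j l b
        = ∑ n, ∑ m, ∑ l, C a i n m * C m j l b * C n l r s := by
          refine Finset.sum_congr rfl fun n _ => ?_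
          rw [Finset.sum_comm]
          refine Finset.sum_congr rfl fun l _ => ?_
          rw [Finset.mul_sum]
          exact Finset.sum_congr rfl fun m _ => mul_comm _ _
      _ = ∑ n, ∑ l, (∑ m, C a n r m * C m l s b) * C i j n l := by
          rw [h]
          refine Finset.sum_congr rfl fun n _ => Finset.sum_congr rfl fun l _ => ?_
          rw [Finset.sum_mul]
          exact Finset.sum_congr rfl fun m _ => by ring
  | mul x y hx hy =>
    rw [map_mul, Bialgebra.comul_mul, map_mul]
    exact Subalgebra.mul_mem _ hx hy
  | add x y hx hy =>
    rw [map_add, map_add, map_add]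
    exact Subalgebra.add_mem _ hx hy

/-- The algebra map `a ↦ r(a, -)` into the convolution algebra. -/
def formHom (hC : BraidEq C) : FRT C →ₐ[k] WithConv (FRT C →ₗ[k] k) :=
  lift C (fun i p => toConv (tForm hC i p)) (by
    intro i j r s
    ext b
    have h := (Subalgebra.mem_centralizer_iff k).1 (rhoKron_comm hC b) _ rfl
    have h1 := congrFun (congrFun h (r, s)) (i, j)
    simp only [Matrix.mul_apply, Matrix.of_apply, Fintype.sum_prod_type] at h1
    symm
    simp only [WithConv.ofConv_sum, WithConv.ofConv_smul, LinearMap.sum_apply,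
      LinearMap.smul_apply, tForm_conv, smul_eq_mul]
    rw [h1]
    exact Finset.sum_congr rfl fun p _ => Finset.sum_congr rfl fun q _ => mul_comm _ _)

/-- The canonical bilinear form `r` on `FRT C`. -/
def form (hC : BraidEq C) : FRT C →ₗ[k] FRT C →ₗ[k] k :=
  (WithConv.linearEquiv k (FRT C →ₗ[k] k)).toLinearMap ∘ₗ (formHom hC).toLinearMap

theorem form_t_t (hC : BraidEq C) (i j p q : ι) : form hC (t C i p) (t C j q) = C j i p q := by
  simp [form, formHom, tForm_apply, rho]

end FRT

/-! ## Weakly graded-Frobenius algebras and the quantum determinant -/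

section WGF

variable {k : Type u} [Field k]

/-- `δ` is a left coaction of the coalgebra `A` on `M`. -/
structure IsCoaction {A M : Type*} [AddCommGroup A] [Module k A] [Coalgebra k A]
    [AddCommGroup M] [Module k M] (δ : M →ₗ[k] A ⊗[k] M) : Prop where
  coassoc : (TensorProduct.assoc k A A M).toLinearMap ∘ₗ
    (Coalgebra.comul (R := k) (A := A)).rTensor M ∘ₗ δ = δ.lTensor A ∘ₗ δ
  counit : (TensorProduct.lid k M).toLinearMap ∘ₗ
    (Coalgebra.counit (R := k) (A := A)).rTensor M ∘ₗ δ = LinearMap.id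

/-- The homogeneous component of degree `n - 1`, which is zero for `n = 0`. -/
def predComponent {B : Type*} [Ring B] [Algebra k B] (𝓑 : ℕ → Submodule k B) :
    ℕ → Submodule k B
  | 0 => ⊥
  | n + 1 => 𝓑 n

/-- The multiplication `P × Q → B` is non-degenerate on both sides. -/
def NondegenerateMul {B : Type*} [Ring B] [Algebra k B] (P Q : Submodule k B) : Prop :=
  (∀ y ∈ P, (∀ z ∈ Q, y * z = 0) → y = 0) ∧ (∀ z ∈ Q, (∀ y ∈ P, y * z = 0) → z = 0)

/-- A weakly graded-Frobenius algebra structure on the graded algebra `B = ⨁ 𝓑 n`, for the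
bialgebra `A` and the left `A`-comodule `V` with coaction `δ`. -/
structure WGFAlgebra {A V B : Type*} [Ring A] [Bialgebra k A] [AddCommGroup V] [Module k V]
    (δ : V →ₗ[k] A ⊗[k] V) [Ring B] [Algebra k B] (𝓑 : ℕ → Submodule k B)
    [GradedAlgebra 𝓑] where
  /-- The coaction of `A` on `B`, an algebra map. -/
  coact : B →ₐ[k] A ⊗[k] B
  isCoaction : IsCoaction coact.toLinearMap
  coact_mem (n : ℕ) (y : B) (hy : y ∈ 𝓑 n) :
    coact y ∈ LinearMap.range ((𝓑 n).subtype.lTensor A)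
  /-- `B⁰` is the ground field. -/
  connected : 𝓑 0 = 1
  /-- `B¹` is identified with `V`. -/
  equiv : V ≃ₗ[k] 𝓑 1
  coact_equiv (v : V) :
    coact (equiv v : B) = ((𝓑 1).subtype ∘ₗ equiv.toLinearMap).lTensor A (δ v)
  finite : Module.Finite k B
  /-- The largest degree in which `B` does not vanish. -/
  top : ℕ
  top_ne_bot : 𝓑 top ≠ ⊥
  eq_bot_of_top_lt (n : ℕ) (hn : top < n) : 𝓑 n = ⊥
  finrank_top : Module.finrank k (𝓑 top) = 1
  nondegenerate_left : NondegenerateMul (𝓑 1) (predComponent 𝓑 top)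
  nondegenerate_right : NondegenerateMul (predComponent 𝓑 top) (𝓑 1)

namespace WGFAlgebra

variable {A V B : Type*} [Ring A] [Bialgebra k A] [AddCommGroup V] [Module k V]
    {δ : V →ₗ[k] A ⊗[k] V} [Ring B] [Algebra k B] {𝓑 : ℕ → Submodule k B}
    [GradedAlgebra 𝓑] (W : WGFAlgebra δ 𝓑)

theorem tmul_right_injective {M : Type*} [AddCommGroup M] [Module k M] {b : B} (hb : b ≠ 0) :
    Function.Injective fun a : M => a ⊗ₜ[k] b := by
  have h := Module.Flat.lTensor_preserves_injective_linearMap (M := M)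
    (LinearMap.toSpanSingleton k B b) (by
      intro c d hcd
      exact smul_left_injective k hb (by simpa using hcd))
  intro a a' haa
  apply (TensorProduct.rid k M).symm.injective
  apply h
  simpa using haa

theorem exists_det : ∃ D : GroupLike k A, ∀ b ∈ 𝓑 W.top, W.coact b = (D : A) ⊗ₜ[k] b := by
  obtain ⟨b, hb0, hb⟩ := finrank_eq_one_iff'.1 W.finrank_top
  have hb0' : (b : B) ≠ 0 := fun h => hb0 (Subtype.ext h)
  obtain ⟨D, hD⟩ : ∃ D : A, W.coact b = D ⊗ₜ[k] (b : B) := by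
    obtain ⟨z, hz⟩ := W.coact_mem W.top b b.2
    rw [← hz]
    clear hz
    induction z using TensorProduct.induction_on with
    | zero => exact ⟨0, by simp⟩
    | tmul a y =>
      obtain ⟨c, rfl⟩ := hb y
      exact ⟨c • a, by simp [TensorProduct.smul_tmul]⟩
    | add y z hy hz =>
      obtain ⟨D, hD⟩ := hy
      obtain ⟨E, hE⟩ := hz
      exact ⟨D + E, by rw [map_add, hD, hE, TensorProduct.add_tmul]⟩
  have h1 := LinearMap.congr_fun W.isCoaction.coassoc (b : B)
  have h2 := LinearMap.congr_fun W.isCoaction.counit (b : B)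
  simp only [LinearMap.comp_apply, AlgHom.toLinearMap_apply, hD, LinearMap.rTensor_tmul,
    LinearMap.lTensor_tmul, LinearEquiv.coe_coe, LinearMap.id_apply,
    TensorProduct.lid_tmul] at h1 h2
  refine ⟨⟨D, ?_, ?_⟩, ?_⟩
  · refine smul_left_injective k hb0' ?_
    simpa using h2
  · apply tmul_right_injective (k := k) hb0'
    apply (TensorProduct.assoc k A A B).injective
    simpa using h1
  · intro y hy
    obtain ⟨c, hc⟩ := hb ⟨y, hy⟩
    have hc' : y = c • (b : B) := (congrArg Subtype.val hc).symm
    rw [hc', map_smul, hD, TensorProduct.tmul_smul]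

/-- The quantum determinant: the group-like element `D` with `λ(b) = D ⊗ b` on the top
component of `B`. -/
def det : GroupLike k A := W.exists_det.choose

theorem coact_top {b : B} (hb : b ∈ 𝓑 W.top) : W.coact b = (W.det : A) ⊗ₜ[k] b :=
  W.exists_det.choose_spec b hb

variable {ι : Type*} [Fintype ι] [DecidableEq ι]

theorem coact_predComponent {y : B} (hy : y ∈ predComponent 𝓑 W.top) :
    W.coact y ∈ LinearMap.range ((predComponent 𝓑 W.top).subtype.lTensor A) := by
  generalize W.top = n at hy
  cases n with
  | zero =>
    have : y = 0 := by simpa [predComponent] using hy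
    rw [this, map_zero]
    exact Submodule.zero_mem _
  | succ n => exact W.coact_mem n y hy

theorem mul_mem_top {y z : B} (hy : y ∈ 𝓑 1) (hz : z ∈ predComponent 𝓑 W.top) :
    y * z ∈ 𝓑 W.top := by
  generalize W.top = n at hz
  cases n with
  | zero =>
    have : z = 0 := by simpa [predComponent] using hz
    rw [this, mul_zero]
    exact Submodule.zero_mem _
  | succ n =>
    rw [add_comm n 1]
    exact SetLike.mul_mem_graded hy hz

theorem exists_dualBasis (x : Module.Basis ι k V) {b : B} (hb : b ∈ 𝓑 W.top) (hb0 : b ≠ 0) :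
    ∃ ω : Module.Basis ι k (predComponent 𝓑 W.top),
      ∀ i j, (W.equiv (x i) : B) * (ω j : B) = if i = j then b else 0 := by
  have hfin : Module.Finite k B := W.finite
  obtain ⟨φ, hφ⟩ := Module.Projective.exists_dual_eq_one k hb0
  have htop : ∀ y ∈ 𝓑 W.top, y = φ y • b := by
    intro y hy
    obtain ⟨a, ha⟩ := (finrank_eq_one_iff_of_nonzero' (⟨b, hb⟩ : 𝓑 W.top)
      (fun h => hb0 (congrArg Subtype.val h))).1 W.finrank_top ⟨y, hy⟩
    have ha' : y = a • b := (congrArg Subtype.val ha).symm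
    rw [ha', map_smul, hφ, smul_eq_mul, mul_one]
  let p : V →ₗ[k] predComponent 𝓑 W.top →ₗ[k] k :=
    ((LinearMap.mul k B).compr₂ φ).compl₁₂ ((𝓑 1).subtype ∘ₗ W.equiv.toLinearMap)
      (predComponent 𝓑 W.top).subtype
  have hp : ∀ v w, p v w = φ ((W.equiv v : B) * (w : B)) := fun v w => rfl
  have h1 : Function.Injective p := by
    rw [injective_iff_map_eq_zero]
    intro v hv
    have h : (W.equiv v : B) = 0 := by
      refine W.nondegenerate_left.1 _ (W.equiv v).2 fun z hz => ?_
      rw [htop _ (W.mul_mem_top (W.equiv v).2 hz), ← hp v ⟨z, hz⟩, hv]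
      simp
    exact W.equiv.map_eq_zero_iff.1 (Subtype.ext h)
  have h2 : Function.Injective p.flip := by
    rw [injective_iff_map_eq_zero]
    intro w hw
    refine Subtype.ext (W.nondegenerate_left.2 _ w.2 fun y hy => ?_)
    obtain ⟨v, hv⟩ := W.equiv.surjective ⟨y, hy⟩
    have hv' : y = W.equiv v := (congrArg Subtype.val hv).symm
    rw [hv', htop _ (W.mul_mem_top (W.equiv v).2 w.2), ← hp v w,
      show p v w = p.flip w v from rfl, hw]
    simp
  have hpp : p.IsPerfPair := LinearMap.IsPerfPair.of_injective' h1 h2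
  refine ⟨x.dualBasis.map p.flip.toPerfPair.symm, fun i j => ?_⟩
  rw [htop _ (W.mul_mem_top (W.equiv (x i)).2 (Subtype.property _)), ← hp, Module.Basis.map_apply,
    LinearMap.apply_toPerfPair_flip, Module.Basis.dualBasis_apply_self]
  by_cases hij : i = j <;> simp [hij]

/-- The basis `ω` of the component of degree `top - 1` with `xᵢ ωʲ = δᵢʲ b`, where `x` is a basis
of `V` and `b` is a volume element. -/
def dualBasis (x : Module.Basis ι k V) {b : B} (hb : b ∈ 𝓑 W.top) (hb0 : b ≠ 0) :
    Module.Basis ι k (predComponent 𝓑 W.top) := (W.exists_dualBasis x hb hb0).choose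

theorem mul_dualBasis (x : Module.Basis ι k V) {b : B} (hb : b ∈ 𝓑 W.top) (hb0 : b ≠ 0)
    (i j : ι) :
    (W.equiv (x i) : B) * (W.dualBasis x hb hb0 j : B) = if i = j then b else 0 :=
  (W.exists_dualBasis x hb hb0).choose_spec i j

theorem exists_cofactor (x : Module.Basis ι k V) {b : B} (hb : b ∈ 𝓑 W.top) (hb0 : b ≠ 0) :
    ∃ T : ι → ι → A, ∀ i, W.coact (W.dualBasis x hb hb0 i : B) =
      ∑ j, T j i ⊗ₜ[k] (W.dualBasis x hb hb0 j : B) := by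
  have key : ∀ y ∈ predComponent 𝓑 W.top, ∃ f : ι → A, W.coact y =
      ∑ j, f j ⊗ₜ[k] (W.dualBasis x hb hb0 j : B) := by
    intro y hy
    obtain ⟨z, hz⟩ := W.coact_predComponent hy
    rw [← hz]
    clear hz
    induction z using TensorProduct.induction_on with
    | zero => exact ⟨0, by simp⟩
    | tmul a y =>
      refine ⟨fun j => (W.dualBasis x hb hb0).repr y j • a, ?_⟩
      have h := congrArg Subtype.val ((W.dualBasis x hb hb0).sum_repr y)
      rw [LinearMap.lTensor_tmul, Submodule.subtype_apply, ← h, Submodule.coe_sum,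
        TensorProduct.tmul_sum]
      simp [TensorProduct.smul_tmul]
    | add y z hy hz =>
      obtain ⟨D, hD⟩ := hy
      obtain ⟨E, hE⟩ := hz
      exact ⟨D + E, by simp [hD, hE, TensorProduct.add_tmul, Finset.sum_add_distrib]⟩
  choose f hf using fun i => key _ (W.dualBasis x hb hb0 i).2
  exact ⟨fun j i => f i j, hf⟩

/-- The elements `Tⱼⁱ` of `A` (first argument `j`, second argument `i`) with
`λ(ωⁱ) = ∑ j, Tⱼⁱ ⊗ ωʲ`. -/
def cofactor (x : Module.Basis ι k V) {b : B} (hb : b ∈ 𝓑 W.top) (hb0 : b ≠ 0) : ι → ι → A :=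
  (W.exists_cofactor x hb hb0).choose

theorem coact_dualBasis (x : Module.Basis ι k V) {b : B} (hb : b ∈ 𝓑 W.top) (hb0 : b ≠ 0)
    (i : ι) : W.coact (W.dualBasis x hb hb0 i : B) =
      ∑ j, W.cofactor x hb hb0 j i ⊗ₜ[k] (W.dualBasis x hb hb0 j : B) :=
  (W.exists_cofactor x hb hb0).choose_spec i

end WGFAlgebra

end WGF

/-- The coaction `xᵢ ↦ ∑ j, tᵢʲ ⊗ xⱼ` of the FRT bialgebra on `V`. -/
def FRT.coaction {k : Type u} {ι : Type w} {V : Type v} [Field k] [Fintype ι] [AddCommGroup V]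
    [Module k V] (C : ι → ι → ι → ι → k) (x : Module.Basis ι k V) : V →ₗ[k] FRT C ⊗[k] V :=
  x.constr k fun i => ∑ j, FRT.t C i j ⊗ₜ[k] x j

/-! ## The localization of the FRT bialgebra at a group-like element -/

section Localization

/-- The inclusion of the free algebra on the `tᵢʲ` into the free algebra on the `tᵢʲ` and one more
generator. -/
def freeIncl (k : Type u) (ι : Type w) [Field k] :
    FreeAlgebra k (ι × ι) →ₐ[k] FreeAlgebra k (ι × ι ⊕ Unit) :=
  FreeAlgebra.lift k fun ij => FreeAlgebra.ι k (Sum.inl ij)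

@[simp]
theorem freeIncl_ι {k : Type u} {ι : Type w} [Field k] (ij : ι × ι) :
    freeIncl k ι (FreeAlgebra.ι k ij) = FreeAlgebra.ι k (Sum.inl ij) := by
  simp [freeIncl]

variable {k : Type u} {ι : Type w} [Field k] [Fintype ι] [DecidableEq ι]
  {C : ι → ι → ι → ι → k}

/-- The relations of the localization of `FRT C` at `D`, on free generators `tᵢʲ` (indexed by
`ι × ι`) and `D⁻¹` (indexed by `Unit`): the FRT relations, and `D D⁻¹ = 1 = D⁻¹ D` for each
expression `d` of `D` in the generators. -/
inductive LocRel (D : FRT C) :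
    FreeAlgebra k (ι × ι ⊕ Unit) → FreeAlgebra k (ι × ι ⊕ Unit) → Prop
  | frt (i j r s : ι) : LocRel D
      (∑ p, ∑ q, C i j p q • (FreeAlgebra.ι k (.inl (p, r)) * FreeAlgebra.ι k (.inl (q, s))))
      (∑ p, ∑ q, C p q r s • (FreeAlgebra.ι k (.inl (i, p)) * FreeAlgebra.ι k (.inl (j, q))))
  | mul_inv (d : FreeAlgebra k (ι × ι)) (hd : FRT.mk C d = D) : LocRel D
      (freeIncl k ι d * FreeAlgebra.ι k (.inr ())) 1
  | inv_mul (d : FreeAlgebra k (ι × ι)) (hd : FRT.mk C d = D) : LocRel D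
      (FreeAlgebra.ι k (.inr ()) * freeIncl k ι d) 1

/-- The localization `H = FRT C [D⁻¹]`. -/
def Loc (D : GroupLike k (FRT C)) : Type (max u w) := RingQuot (LocRel (D : FRT C))

namespace Loc

variable (D : GroupLike k (FRT C))

instance : Ring (Loc D) := inferInstanceAs (Ring (RingQuot (LocRel (D : FRT C))))

instance : Algebra k (Loc D) := inferInstanceAs (Algebra k (RingQuot (LocRel (D : FRT C))))

/-- The quotient map from the free algebra. -/
def mk : FreeAlgebra k (ι × ι ⊕ Unit) →ₐ[k] Loc D := RingQuot.mkAlgHom k (LocRel (D : FRT C))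

/-- The canonical map `FRT C → FRT C [D⁻¹]`, `tᵢʲ ↦ tᵢʲ`. -/
def of : FRT C →ₐ[k] Loc D :=
  FRT.lift C (fun i j => mk D (FreeAlgebra.ι k (.inl (i, j)))) (by
    intro i j r s
    have h : mk D _ = mk D _ := RingQuot.mkAlgHom_rel k (LocRel.frt (D := (D : FRT C)) i j r s)
    simp only [map_sum, map_smul, map_mul] at h
    exact h)

theorem of_t (i j : ι) : of D (FRT.t C i j) = mk D (FreeAlgebra.ι k (.inl (i, j))) :=
  FRT.lift_t C _ _ i j

/-- The generator `D⁻¹`. -/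
def inv : Loc D := mk D (FreeAlgebra.ι k (.inr ()))

theorem of_mk (d : FreeAlgebra k (ι × ι)) : of D (FRT.mk C d) =
    mk D (freeIncl k ι d) := by
  have h : (of D).comp (FRT.mk C) =
      (mk D).comp (freeIncl k ι) := by
    apply FreeAlgebra.hom_ext
    funext ij
    rw [Function.comp_apply, Function.comp_apply, AlgHom.comp_apply, AlgHom.comp_apply, freeIncl_ι]
    exact of_t D ij.1 ij.2
  exact DFunLike.congr_fun h d

theorem mul_inv : of D D * inv D = 1 := by
  obtain ⟨d, hd⟩ := FRT.mk_surjective C (D : FRT C)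
  have h : mk D _ = mk D _ := RingQuot.mkAlgHom_rel k (LocRel.mul_inv (D := (D : FRT C)) d hd)
  rw [map_mul, map_one, ← of_mk, hd] at h
  exact h

theorem inv_mul : inv D * of D D = 1 := by
  obtain ⟨d, hd⟩ := FRT.mk_surjective C (D : FRT C)
  have h : mk D _ = mk D _ := RingQuot.mkAlgHom_rel k (LocRel.inv_mul (D := (D : FRT C)) d hd)
  rw [map_mul, map_one, ← of_mk, hd] at h
  exact h

variable {D} in
theorem hom_ext {B : Type*} [Semiring B] [Algebra k B] {f g : Loc D →ₐ[k] B}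
    (h : ∀ i j, f (of D (FRT.t C i j)) = g (of D (FRT.t C i j))) (hi : f (inv D) = g (inv D)) :
    f = g := by
  apply RingQuot.ringQuot_ext' k
  apply FreeAlgebra.hom_ext
  funext x
  rcases x with ⟨i, j⟩ | ⟨⟩
  · have h1 := h i j
    rw [of_t] at h1
    exact h1
  · exact hi

theorem lift_aux {B : Type*} [Semiring B] [Algebra k B] (f : FRT C →ₐ[k] B) (y : B)
    (h : f D * y = 1) (h' : y * f D = 1) ⦃a b : FreeAlgebra k (ι × ι ⊕ Unit)⦄
    (hab : LocRel (D : FRT C) a b) :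
    FreeAlgebra.lift k (Sum.elim (fun ij => f (FRT.t C ij.1 ij.2)) fun _ => y) a =
      FreeAlgebra.lift k (Sum.elim (fun ij => f (FRT.t C ij.1 ij.2)) fun _ => y) b := by
  have key : ∀ d, FreeAlgebra.lift k (Sum.elim (fun ij => f (FRT.t C ij.1 ij.2)) fun _ => y)
      (freeIncl k ι d) = f (FRT.mk C d) := by
    have h : (FreeAlgebra.lift k (Sum.elim (fun ij => f (FRT.t C ij.1 ij.2)) fun _ => y)).comp
        (freeIncl k ι) =
        f.comp (FRT.mk C) := by
      apply FreeAlgebra.hom_ext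
      funext ij
      simp [FRT.t]
    exact fun d => DFunLike.congr_fun h d
  cases hab with
  | frt i j r s =>
    simp only [map_sum, map_smul, map_mul, FreeAlgebra.lift_ι_apply, Sum.elim_inl]
    simp only [← map_mul, ← map_smul, ← map_sum, FRT.rel]
  | mul_inv d hd => rw [map_mul, key, hd, FreeAlgebra.lift_ι_apply, map_one]; exact h
  | inv_mul d hd => rw [map_mul, key, hd, FreeAlgebra.lift_ι_apply, map_one]; exact h'

/-- The universal property of the localization. -/
def lift {B : Type*} [Semiring B] [Algebra k B] (f : FRT C →ₐ[k] B) (y : B)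
    (h : f D * y = 1) (h' : y * f D = 1) : Loc D →ₐ[k] B :=
  RingQuot.liftAlgHom k
    ⟨FreeAlgebra.lift k (Sum.elim (fun ij => f (FRT.t C ij.1 ij.2)) fun _ => y),
      lift_aux D f y h h'⟩

@[simp]
theorem lift_inv {B : Type*} [Semiring B] [Algebra k B] (f : FRT C →ₐ[k] B) (y : B)
    (h : f D * y = 1) (h' : y * f D = 1) : lift D f y h h' (inv D) = y := by
  have := RingQuot.liftAlgHom_mkAlgHom_apply k _ (lift_aux D f y h h')
    (FreeAlgebra.ι k (.inr ()))
  rw [FreeAlgebra.lift_ι_apply] at this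
  exact this

@[simp]
theorem lift_of {B : Type*} [Semiring B] [Algebra k B] (f : FRT C →ₐ[k] B) (y : B)
    (h : f D * y = 1) (h' : y * f D = 1) (a : FRT C) : lift D f y h h' (of D a) = f a := by
  have key : (lift D f y h h').comp (of D) = f := by
    apply FRT.hom_ext
    intro i j
    have := RingQuot.liftAlgHom_mkAlgHom_apply k _ (lift_aux D f y h h')
      (FreeAlgebra.ι k (.inl (i, j)))
    rw [FreeAlgebra.lift_ι_apply] at this
    rw [AlgHom.comp_apply, of_t]
    exact this
  exact DFunLike.congr_fun key a

/-- The comultiplication, extending that of `FRT C` by `D⁻¹ ↦ D⁻¹ ⊗ D⁻¹`. -/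
def comulHom : Loc D →ₐ[k] Loc D ⊗[k] Loc D :=
  lift D ((Algebra.TensorProduct.map (of D) (of D)).comp (Bialgebra.comulAlgHom k (FRT C)))
    (inv D ⊗ₜ[k] inv D)
    (by simp [mul_inv, Algebra.TensorProduct.one_def])
    (by simp [inv_mul, Algebra.TensorProduct.one_def])

/-- The counit, extending that of `FRT C` by `D⁻¹ ↦ 1`. -/
def counitHom : Loc D →ₐ[k] k :=
  lift D (Bialgebra.counitAlgHom k (FRT C)) 1 (by simp) (by simp)

instance instBialgebra : Bialgebra k (Loc D) :=
  Bialgebra.ofAlgHom (comulHom D) (counitHom D)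
    (by
      apply hom_ext
      · intro i j
        simp only [comulHom, AlgHom.comp_apply, lift_of, Bialgebra.comulAlgHom_apply, FRT.comul_t,
          map_sum, Algebra.TensorProduct.map_tmul,
          TensorProduct.sum_tmul, TensorProduct.tmul_sum, AlgHom.id_apply]
        rw [Finset.sum_comm]
        simp
      · simp [comulHom])
    (by
      apply hom_ext
      · intro i j
        simp [comulHom, counitHom, TensorProduct.ite_tmul]
      · simp [comulHom, counitHom])
    (by
      apply hom_ext
      · intro i j
        simp [comulHom, counitHom, TensorProduct.tmul_ite]
      · simp [comulHom, counitHom])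

end Loc

end Localization

end QDet

end

/-! Everything follows from inverting the matrix `t` of generators over the localization. Applying
the multiplicative coaction to `xᵢ ωʲ = δᵢʲ b` gives `t T = D`, so `T D⁻¹` is a right inverse of `t`
(`WGFAlgebra.sum_t_mul_cofactor`). In the localization Hayashi's map is conjugation by `D`
(`Loc.of_hayashi_mul`), so the hypothesis reads `D T D⁻¹ t = D`, and cancelling `D` shows that `T
D⁻¹` is also a left inverse.

The inverse of a matrix satisfying the FRT relations satisfies them in the opposite algebra
(`frt_rel_inverse`). It therefore defines an anti-homomorphism, which is convolution inverse to
`Loc.of`: for a homomorphism and an anti-homomorphism this need only be checked on generators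
(`IsConvInv.of_adjoin`). Convolution inverse maps take mutually inverse values at a group-like
element, so both extend to `D⁻¹` (`Loc.exists_isConvInv`). The extension of `Loc.of` is the
identity, and its partner is the antipode.

The same extension principle, used once per variable, carries the bilinear form to the localization.
The representation `rho` extends because the coefficients of `c⁻¹` provide a convolution inverse of
its transpose (`Loc.exists_rho`). The matrix entries of the extension then define `a ↦ r(a, -)` on
the generators, again with a convolution inverse (`Loc.exists_formHom`). The remaining axioms are
identities between algebra maps or intertwining relations, so they reduce to the generators `tᵢʲ` by
`Loc.intertwine`, which handles `D⁻¹` automatically. -/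

noncomputable section

namespace QDet

universe u v w

/-! ### Convolution inverses of algebra homomorphisms -/

section ConvInv

open WithConv

variable {k : Type u} [Field k] {X B : Type*} [Ring X] [Bialgebra k X] [Ring B] [Algebra k B]

/-- An algebra map to the opposite algebra, as a linear map to the algebra. -/
def unopLin (g : X →ₐ[k] Bᵐᵒᵖ) : X →ₗ[k] B :=
  (MulOpposite.opLinearEquiv k).symm.toLinearMap ∘ₗ g.toLinearMap

@[simp]
theorem unopLin_apply (g : X →ₐ[k] Bᵐᵒᵖ) (a : X) : unopLin g a = (g a).unop := rfl

/-- The anti-homomorphism `g` is convolution inverse to the homomorphism `f`. -/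
structure IsConvInv (f : X →ₐ[k] B) (g : X →ₐ[k] Bᵐᵒᵖ) : Prop where
  mul_eq_one : toConv f.toLinearMap * toConv (unopLin g) = 1
  eq_one_mul : toConv (unopLin g) * toConv f.toLinearMap = 1

/-- Since `g` reverses products, `f(x₁y₁) g(x₂y₂) = f(x₁) (f(y₁) g(y₂)) g(x₂)`; the inner factor is
a scalar and can be pulled out. This is the multiplicative step of `IsConvInv.of_adjoin`. In the
mirror statement for `g * f` it is the left factor that ends up inside. -/
theorem mul'_map_mul_of_right (f : X →ₐ[k] B) (g : X →ₐ[k] Bᵐᵒᵖ) (z w : X ⊗[k] X) (c : k)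
    (hw : LinearMap.mul' k B (TensorProduct.map f.toLinearMap (unopLin g) w) =
      algebraMap k B c) :
    LinearMap.mul' k B (TensorProduct.map f.toLinearMap (unopLin g) (z * w)) =
      LinearMap.mul' k B (TensorProduct.map f.toLinearMap (unopLin g) z) * algebraMap k B c := by
  induction z using TensorProduct.induction_on with
  | zero => simp
  | add x y hx hy => simp only [add_mul, map_add, hx, hy]
  | tmul x y =>
    have key : LinearMap.mul' k B (TensorProduct.map f.toLinearMap (unopLin g) (x ⊗ₜ y * w)) =
        f x * LinearMap.mul' k B (TensorProduct.map f.toLinearMap (unopLin g) w) *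
          (g y).unop := by
      clear hw
      induction w using TensorProduct.induction_on with
      | zero => simp
      | add x y hx hy => simp only [mul_add, add_mul, map_add, hx, hy]
      | tmul x' y' => simp [mul_assoc]
    rw [key, hw]
    simp [mul_assoc, Algebra.commutes]

theorem mul'_map_mul_of_left (f : X →ₐ[k] B) (g : X →ₐ[k] Bᵐᵒᵖ) (z w : X ⊗[k] X) (c : k)
    (hz : LinearMap.mul' k B (TensorProduct.map (unopLin g) f.toLinearMap z) =
      algebraMap k B c) :
    LinearMap.mul' k B (TensorProduct.map (unopLin g) f.toLinearMap (z * w)) =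
      algebraMap k B c * LinearMap.mul' k B (TensorProduct.map (unopLin g) f.toLinearMap w) := by
  induction w using TensorProduct.induction_on with
  | zero => simp
  | add x y hx hy => simp only [mul_add, map_add, hx, hy]
  | tmul x y =>
    have key : LinearMap.mul' k B (TensorProduct.map (unopLin g) f.toLinearMap (z * x ⊗ₜ y)) =
        (g x).unop * LinearMap.mul' k B (TensorProduct.map (unopLin g) f.toLinearMap z) *
          f y := by
      clear hz
      induction z using TensorProduct.induction_on with
      | zero => simp
      | add x y hx hy => simp only [mul_add, add_mul, map_add, hx, hy]
      | tmul x' y' => simp [mul_assoc]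
    rw [key, hz]
    simp [← mul_assoc, Algebra.commutes]

theorem IsConvInv.of_adjoin {f : X →ₐ[k] B} {g : X →ₐ[k] Bᵐᵒᵖ} {s : Set X}
    (hs : Algebra.adjoin k s = ⊤)
    (h1 : ∀ a ∈ s, LinearMap.mul' k B (TensorProduct.map f.toLinearMap (unopLin g)
      (Coalgebra.comul a)) = algebraMap k B (Coalgebra.counit (R := k) a))
    (h2 : ∀ a ∈ s, LinearMap.mul' k B (TensorProduct.map (unopLin g) f.toLinearMap
      (Coalgebra.comul a)) = algebraMap k B (Coalgebra.counit (R := k) a)) :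
    IsConvInv f g := by
  constructor
  · ext a
    have ha : a ∈ Algebra.adjoin k s := hs ▸ Algebra.mem_top
    rw [LinearMap.convMul_apply, LinearMap.convOne_apply]
    induction ha using Algebra.adjoin_induction with
    | mem a ha => exact h1 a ha
    | algebraMap c => simp [Algebra.TensorProduct.algebraMap_apply]
    | add x y _ _ hx hy => simp only [map_add, hx, hy]
    | mul x y _ _ hx hy =>
      rw [Bialgebra.comul_mul, mul'_map_mul_of_right f g _ _ _ hy, hx, Bialgebra.counit_mul,
        map_mul]
  · ext a
    have ha : a ∈ Algebra.adjoin k s := hs ▸ Algebra.mem_top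
    rw [LinearMap.convMul_apply, LinearMap.convOne_apply]
    induction ha using Algebra.adjoin_induction with
    | mem a ha => exact h2 a ha
    | algebraMap c => simp [Algebra.TensorProduct.algebraMap_apply]
    | add x y _ _ hx hy => simp only [map_add, hx, hy]
    | mul x y _ _ hx hy =>
      rw [Bialgebra.comul_mul, mul'_map_mul_of_left f g _ _ _ hx, hy, Bialgebra.counit_mul,
        map_mul]

/-- At a group-like element a convolution product is a product of values and the counit is 1. This
makes `f D` invertible, as an extension to `D⁻¹` requires. -/
theorem IsConvInv.groupLike_mul {f : X →ₐ[k] B} {g : X →ₐ[k] Bᵐᵒᵖ} (h : IsConvInv f g)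
    (D : GroupLike k X) : f D * (g D).unop = 1 := by
  have h1 := LinearMap.congr_fun (congrArg WithConv.ofConv h.mul_eq_one) (D : X)
  simpa using h1

theorem IsConvInv.mul_groupLike {f : X →ₐ[k] B} {g : X →ₐ[k] Bᵐᵒᵖ} (h : IsConvInv f g)
    (D : GroupLike k X) : (g D).unop * f D = 1 := by
  have h1 := LinearMap.congr_fun (congrArg WithConv.ofConv h.eq_one_mul) (D : X)
  simpa using h1

end ConvInv

/-! ### Reduction to generators, and extension of maps to the localization -/

section Generators

variable {k : Type u} {ι : Type w} [Field k] [Fintype ι] {C : ι → ι → ι → ι → k}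

theorem FRT.adjoin_t : Algebra.adjoin k (Set.range fun ij : ι × ι => FRT.t C ij.1 ij.2) = ⊤ := by
  have h := congrArg (Subalgebra.map (FRT.mk C)) (FreeAlgebra.adjoin_range_ι k (ι × ι))
  rw [AlgHom.map_adjoin, ← Set.range_comp, Algebra.map_top,
    (AlgHom.range_eq_top _).2 (FRT.mk_surjective C)] at h
  exact h

variable [DecidableEq ι]

theorem Loc.adjoin_of_t (D : GroupLike k (FRT C)) :
    Algebra.adjoin k (insert (Loc.inv D)
      (Set.range fun ij : ι × ι => Loc.of D (FRT.t C ij.1 ij.2))) = ⊤ := by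
  have h := congrArg (Subalgebra.map (Loc.mk D)) (FreeAlgebra.adjoin_range_ι k (ι × ι ⊕ Unit))
  rw [AlgHom.map_adjoin, ← Set.range_comp, Algebra.map_top,
    (AlgHom.range_eq_top (Loc.mk D)).2 (RingQuot.mkAlgHom_surjective k _)] at h
  rw [← h]
  congr 1
  ext y
  simp [Loc.inv, Loc.of_t, eq_comm]
  rw [or_comm]
  refine or_congr_right ⟨fun h => ⟨(), h⟩, fun ⟨_, h⟩ => h⟩

theorem Loc.comul_of (D : GroupLike k (FRT C)) (a : FRT C) :
    Coalgebra.comul (R := k) (Loc.of D a) =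
      TensorProduct.map (Loc.of D).toLinearMap (Loc.of D).toLinearMap (Coalgebra.comul a) :=
  Loc.lift_of D _ _ _ _ a

@[simp]
theorem Loc.comul_of_t (D : GroupLike k (FRT C)) (i j : ι) :
    Coalgebra.comul (R := k) (Loc.of D (FRT.t C i j)) =
      ∑ m, Loc.of D (FRT.t C i m) ⊗ₜ[k] Loc.of D (FRT.t C m j) := by
  simp [Loc.comul_of]

@[simp]
theorem Loc.counit_of (D : GroupLike k (FRT C)) (a : FRT C) :
    Coalgebra.counit (R := k) (Loc.of D a) = Coalgebra.counit (R := k) a :=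
  Loc.lift_of D _ _ _ _ a

@[simp]
theorem Loc.comul_inv (D : GroupLike k (FRT C)) :
    Coalgebra.comul (R := k) (Loc.inv D) = Loc.inv D ⊗ₜ[k] Loc.inv D :=
  Loc.lift_inv D _ _ _ _

@[simp]
theorem Loc.counit_inv (D : GroupLike k (FRT C)) :
    Coalgebra.counit (R := k) (Loc.inv D) = 1 :=
  Loc.lift_inv D _ _ _ _

/-- The canonical map to the localization is a map of coalgebras. -/
def Loc.ofCoalgHom (D : GroupLike k (FRT C)) : FRT C →ₗc[k] Loc D where
  __ := (Loc.of D).toLinearMap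
  counit_comp := by ext a; simp
  map_comp_comul := by ext a; simp [Loc.comul_of]

@[simp]
theorem Loc.ofCoalgHom_apply (D : GroupLike k (FRT C)) (a : FRT C) :
    Loc.ofCoalgHom D a = Loc.of D a := rfl

/-- An element which intertwines two algebra maps on the generators `tᵢʲ` intertwines them. -/
theorem Loc.intertwine {E : Type*} [Ring E] [Algebra k E] {D : GroupLike k (FRT C)}
    {α β : Loc D →ₐ[k] E} {z : E}
    (h : ∀ i j, α (Loc.of D (FRT.t C i j)) * z = z * β (Loc.of D (FRT.t C i j))) (a : Loc D) :
    α a * z = z * β a := by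
  have closed : ∀ x y : Loc D, α x * z = z * β x → α y * z = z * β y →
      α (x * y) * z = z * β (x * y) := by
    intro x y hx hy
    rw [map_mul, map_mul, mul_assoc, hy, ← mul_assoc, hx, mul_assoc]
  have hof : ∀ a : FRT C, α (Loc.of D a) * z = z * β (Loc.of D a) := by
    intro a
    have ha : a ∈ Algebra.adjoin k (Set.range fun ij : ι × ι => FRT.t C ij.1 ij.2) :=
      FRT.adjoin_t (C := C) ▸ Algebra.mem_top
    induction ha using Algebra.adjoin_induction with
    | mem a ha =>
      obtain ⟨ij, rfl⟩ := ha
      exact h ij.1 ij.2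
    | algebraMap c => simp [Algebra.commutes]
    | add x y _ _ hx hy => simp only [map_add, add_mul, mul_add, hx, hy]
    | mul x y _ _ hx hy =>
      rw [map_mul]
      exact closed _ _ hx hy
  have ha : a ∈ Algebra.adjoin k (insert (Loc.inv D)
      (Set.range fun ij : ι × ι => Loc.of D (FRT.t C ij.1 ij.2))) :=
    Loc.adjoin_of_t D ▸ Algebra.mem_top
  induction ha using Algebra.adjoin_induction with
  | mem a ha =>
    rcases ha with rfl | ⟨ij, rfl⟩
    -- The relation for `D⁻¹` comes from the one for `D`, already known from `hof`, by multiplying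
    -- with the inverses on both sides.
    · calc α (Loc.inv D) * z = α (Loc.inv D) * z * β (Loc.of D D * Loc.inv D) := by
            simp [Loc.mul_inv]
        _ = α (Loc.inv D) * (z * β (Loc.of D D)) * β (Loc.inv D) := by
            rw [map_mul]; simp only [mul_assoc]
        _ = α (Loc.inv D * Loc.of D D) * z * β (Loc.inv D) := by
            rw [← hof, map_mul]; simp only [mul_assoc]
        _ = z * β (Loc.inv D) := by simp [Loc.inv_mul]
    · exact h ij.1 ij.2
  | algebraMap c => simp [Algebra.commutes]
  | add x y _ _ hx hy => simp only [map_add, add_mul, mul_add, hx, hy]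
  | mul x y _ _ hx hy => exact closed _ _ hx hy

/-- The localization is an epimorphic extension: a map is determined at `D⁻¹` by its value at `D`.
This is `Loc.intertwine` with `z = 1`. -/
theorem Loc.intertwine_eq {E : Type*} [Ring E] [Algebra k E] {D : GroupLike k (FRT C)}
    {α β : Loc D →ₐ[k] E}
    (h : ∀ i j, α (Loc.of D (FRT.t C i j)) = β (Loc.of D (FRT.t C i j))) : α = β := by
  ext a
  simpa using Loc.intertwine (z := 1) (α := α) (β := β) (by simpa using h) a

theorem FRT.isConvInv {B : Type*} [Ring B] [Algebra k B] {f : FRT C →ₐ[k] B}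
    {g : FRT C →ₐ[k] Bᵐᵒᵖ}
    (hfg : ∀ i j, ∑ m, f (FRT.t C i m) * (g (FRT.t C m j)).unop = if i = j then 1 else 0)
    (hgf : ∀ i j, ∑ m, (g (FRT.t C i m)).unop * f (FRT.t C m j) = if i = j then 1 else 0) :
    IsConvInv f g := by
  refine IsConvInv.of_adjoin FRT.adjoin_t ?_ ?_
  · rintro _ ⟨⟨i, j⟩, rfl⟩
    simp [hfg, apply_ite (algebraMap k B)]
  · rintro _ ⟨⟨i, j⟩, rfl⟩
    simp [hgf, apply_ite (algebraMap k B)]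

/-- Mutually convolution inverse maps on `FRT C` extend to the localization. -/
theorem Loc.exists_isConvInv (D : GroupLike k (FRT C)) {B : Type*} [Ring B] [Algebra k B]
    {f : FRT C →ₐ[k] B} {g : FRT C →ₐ[k] Bᵐᵒᵖ} (h : IsConvInv f g) :
    ∃ (F : Loc D →ₐ[k] B) (G : Loc D →ₐ[k] Bᵐᵒᵖ), IsConvInv F G ∧
      (∀ a, F (Loc.of D a) = f a) ∧ (∀ a, G (Loc.of D a) = g a) ∧
      G (Loc.inv D) = MulOpposite.op (f D) := by
  have h1 := h.groupLike_mul D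
  have h2 := h.mul_groupLike D
  -- Each map sends `D⁻¹` to the value of the other one at `D`.
  refine ⟨Loc.lift D f (g D).unop h1 h2,
    Loc.lift D g (MulOpposite.op (f D)) (MulOpposite.unop_injective (by simpa using h1))
      (MulOpposite.unop_injective (by simpa using h2)), ?_, by simp, by simp, by simp⟩
  refine IsConvInv.of_adjoin (Loc.adjoin_of_t D) ?_ ?_
  · rintro _ (rfl | ⟨⟨i, j⟩, rfl⟩)
    · simp [h2]
    · have := LinearMap.congr_fun (congrArg WithConv.ofConv h.mul_eq_one) (FRT.t C i j)
      simpa using this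
  · rintro _ (rfl | ⟨⟨i, j⟩, rfl⟩)
    · simp [h1]
    · have := LinearMap.congr_fun (congrArg WithConv.ofConv h.eq_one_mul) (FRT.t C i j)
      simpa using this

/-- If a matrix `t` satisfies the FRT relations, then its inverse satisfies them in the opposite
algebra. -/
theorem frt_rel_inverse {B : Type*} [Ring B] [Algebra k B] {t s : ι → ι → B}
    (C : ι → ι → ι → ι → k)
    (h : ∀ i j r l, ∑ p, ∑ q, C i j p q • (t p r * t q l) =
      ∑ p, ∑ q, C p q r l • (t i p * t j q))
    (hts : ∀ i j, ∑ m, t i m * s m j = if i = j then 1 else 0)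
    (hst : ∀ i j, ∑ m, s i m * t m j = if i = j then 1 else 0) (i j r l : ι) :
    ∑ p, ∑ q, C i j p q • (s q l * s p r) = ∑ p, ∑ q, C p q r l • (s j q * s i p) := by
  let M : Matrix (ι × ι) (ι × ι) B := Matrix.of fun x y => algebraMap k B (C x.1 x.2 y.1 y.2)
  let T : Matrix (ι × ι) (ι × ι) B := Matrix.of fun x y => t x.1 y.1 * t x.2 y.2
  -- The factors are in reverse order so that in `T * S` and `S * T` the inner pair cancels first,
  -- with no commutativity in `B`.
  let S : Matrix (ι × ι) (ι × ι) B := Matrix.of fun x y => s x.2 y.2 * s x.1 y.1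
  have hMT : M * T = T * M := by
    ext ⟨i, j⟩ ⟨r, l⟩
    simpa [M, T, Matrix.mul_apply, Fintype.sum_prod_type, Algebra.smul_def,
      ← Algebra.commutes (R := k)] using h i j r l
  have hTS : T * S = 1 := by
    ext ⟨i, j⟩ ⟨r, l⟩
    simp only [T, S, Matrix.mul_apply, Matrix.of_apply, Fintype.sum_prod_type]
    calc ∑ p, ∑ q, t i p * t j q * (s q l * s p r)
        = ∑ p, t i p * (∑ q, t j q * s q l) * s p r := by
          simp only [Finset.mul_sum, Finset.sum_mul, mul_assoc]
      _ = _ := by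
          rw [hts]
          by_cases hjl : j = l <;> simp [hjl, hts, Matrix.one_apply]
  have hST : S * T = 1 := by
    ext ⟨i, j⟩ ⟨r, l⟩
    simp only [T, S, Matrix.mul_apply, Matrix.of_apply, Fintype.sum_prod_type]
    rw [Finset.sum_comm]
    calc ∑ q, ∑ p, s j q * s i p * (t p r * t q l)
        = ∑ q, s j q * (∑ p, s i p * t p r) * t q l := by
          simp only [Finset.mul_sum, Finset.sum_mul, mul_assoc]
      _ = _ := by
          rw [hst]
          by_cases hir : i = r <;> simp [hir, hst, Matrix.one_apply]
  -- The FRT relations say that `T` commutes with `M`; hence so does its inverse `S`.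
  have hSM : M * S = S * M := by
    calc M * S = S * T * (M * S) := by rw [hST, one_mul]
      _ = S * (T * M) * S := by simp only [mul_assoc]
      _ = S * M * (T * S) := by rw [← hMT]; simp only [mul_assoc]
      _ = S * M := by rw [hTS, mul_one]
  have h1 := congrFun (congrFun hSM (i, j)) (r, l)
  simpa [M, S, Matrix.mul_apply, Fintype.sum_prod_type, Algebra.smul_def,
      ← Algebra.commutes (R := k)] using h1

/-- The matrix inverse of the images of the generators defines a convolution inverse. -/
theorem FRT.exists_isConvInv {B : Type*} [Ring B] [Algebra k B] (f : FRT C →ₐ[k] B)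
    (s : ι → ι → B) (hfs : ∀ i j, ∑ m, f (FRT.t C i m) * s m j = if i = j then 1 else 0)
    (hsf : ∀ i j, ∑ m, s i m * f (FRT.t C m j) = if i = j then 1 else 0) :
    ∃ g : FRT C →ₐ[k] Bᵐᵒᵖ, IsConvInv f g ∧
      ∀ i j, g (FRT.t C i j) = MulOpposite.op (s i j) := by
  have hrel := frt_rel_inverse (t := fun i j => f (FRT.t C i j)) C
    (fun i j r l => by simpa using congrArg f (FRT.rel C i j r l)) hfs hsf
  refine ⟨FRT.lift C (fun i j => MulOpposite.op (s i j)) fun i j r l => ?_, ?_, by simp⟩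
  · apply MulOpposite.unop_injective
    simpa using hrel i j r l
  · exact FRT.isConvInv (by simpa using hfs) (by simpa using hsf)

end Generators

/-! ### Extending the form to the localization in each variable -/

section Matrices

open WithConv

variable {k : Type u} {ι : Type w} [Field k] [Fintype ι] [DecidableEq ι]

theorem braidCoeff_mul_symm {V : Type*} [AddCommGroup V] [Module k V] (x : Module.Basis ι k V)
    (c : V ⊗[k] V ≃ₗ[k] V ⊗[k] V) (i j r s : ι) :
    ∑ p, ∑ q, braidCoeff x c i j p q * braidCoeff x c.symm p q r s =
      if i = r then (if j = s then 1 else 0) else 0 := by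
  have h := congrArg c.symm (braid_basis x c i j)
  simp only [LinearEquiv.symm_apply_apply, map_sum, map_smul] at h
  have h2 := congrArg (fun z => (x.tensorProduct x).repr z (r, s)) h
  simp only [map_sum, map_smul, Finsupp.coe_finsetSum, Finset.sum_apply, Finsupp.smul_apply,
    Module.Basis.tensorProduct_repr_tmul_apply, Module.Basis.repr_self, smul_eq_mul,
    Finsupp.single_apply] at h2
  rw [show (∑ p, ∑ q, braidCoeff x c i j p q * braidCoeff x c.symm p q r s) = _ from h2.symm]
  by_cases hi : i = r <;> by_cases hj : j = s <;> simp [hi, hj]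

variable {C C' : ι → ι → ι → ι → k} (D : GroupLike k (FRT C))

/-- The representation `rho` extends to the localization, and its transpose has a convolution
inverse. -/
theorem Loc.exists_rho (hC : BraidEq C)
    (hCC' : ∀ i j r s, ∑ p, ∑ q, C i j p q * C' p q r s =
      if i = r then (if j = s then 1 else 0) else 0)
    (hC'C : ∀ i j r s, ∑ p, ∑ q, C' i j p q * C p q r s =
      if i = r then (if j = s then 1 else 0) else 0) :
    ∃ σ ρ : Loc D →ₐ[k] Matrix ι ι k, (∀ a, ρ (Loc.of D a) = FRT.rho hC a) ∧
      IsConvInv σ ((Matrix.transposeAlgEquiv ι k k).toAlgHom.comp ρ) := by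
  let t : ι → ι → Matrix ι ι k := fun i j => (FRT.rho hC (FRT.t C i j)).transpose
  -- The indices are arranged so that `t s = 1` and `s t = 1` become the two identities between the
  -- coefficients of `c` and of its inverse.
  let s : ι → ι → Matrix ι ι k := fun i j => Matrix.of fun a p => C' a i j p
  have ht : ∀ i j p q, t i j p q = C i p q j := fun i j p q => by simp [t, FRT.rho]
  have hts : ∀ i j, ∑ m, t i m * s m j = if i = j then 1 else 0 := by
    intro i j
    ext a b
    simp only [Matrix.sum_apply, Matrix.mul_apply, ht, s, Matrix.of_apply]
    rw [Finset.sum_comm, hCC']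
    by_cases hij : i = j <;> simp [hij, Matrix.one_apply]
  have hst : ∀ i j, ∑ m, s i m * t m j = if i = j then 1 else 0 := by
    intro i j
    ext a b
    simp only [Matrix.sum_apply, Matrix.mul_apply, ht, s, Matrix.of_apply]
    rw [hC'C]
    by_cases hij : i = j <;> simp [hij, Matrix.one_apply]
  -- Transposition reverses products, so `t` satisfies the relations with both pairs of indices of
  -- `C` swapped. Passing to the inverse reverses products once more, so `s` defines a genuine
  -- homomorphism `σ₀`.
  have hrel := frt_rel_inverse (t := t) (s := s) (fun i j r l => C j i l r) (by
    intro i j r l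
    have h := congrArg Matrix.transpose (congrArg (FRT.rho hC) (FRT.rel C j i l r))
    simp only [map_sum, map_smul, map_mul, Matrix.transpose_sum, Matrix.transpose_smul,
      Matrix.transpose_mul] at h
    rw [Finset.sum_comm, h, Finset.sum_comm]) hts hst
  let σ₀ : FRT C →ₐ[k] Matrix ι ι k := FRT.lift C s fun i j r l => by
    rw [Finset.sum_comm, hrel j i l r, Finset.sum_comm]
  have hconv : IsConvInv σ₀ ((Matrix.transposeAlgEquiv ι k k).toAlgHom.comp (FRT.rho hC)) := by
    refine FRT.isConvInv (fun i j => ?_) (fun i j => ?_)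
    · simpa [σ₀, Matrix.transposeAlgEquiv] using hst i j
    · simpa [σ₀, Matrix.transposeAlgEquiv] using hts i j
  obtain ⟨σ, G, hσG, -, hG, -⟩ := Loc.exists_isConvInv D hconv
  -- The extension theorem yields the extended transpose `G`; transposing back gives the extension
  -- of `rho`.
  refine ⟨σ, (Matrix.transposeAlgEquiv ι k k).symm.toAlgHom.comp G, fun a => ?_, ?_⟩
  · simp [hG]
  · convert hσG using 1
    ext a
    simp

variable {D}

/-- These are the entries of a single statement: the Kronecker square of `ρ`, composed with the
comultiplication, commutes with the matrix of `C`. On the image of `FRT C` this is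
`FRT.rhoKron_comm`, and `Loc.intertwine` extends it. -/
theorem Loc.rho_rel (hC : BraidEq C) {ρ : Loc D →ₐ[k] Matrix ι ι k}
    (hρ : ∀ a, ρ (Loc.of D a) = FRT.rho hC a) (i j r s : ι) :
    ∑ p, ∑ q, C i j p q •
        (toConv (Matrix.entryLinearMap k k r p ∘ₗ ρ.toLinearMap) *
          toConv (Matrix.entryLinearMap k k s q ∘ₗ ρ.toLinearMap)) =
      ∑ p, ∑ q, C p q r s •
        (toConv (Matrix.entryLinearMap k k p i ∘ₗ ρ.toLinearMap) *
          toConv (Matrix.entryLinearMap k k q j ∘ₗ ρ.toLinearMap)) := by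
  let K : Loc D →ₐ[k] Matrix (ι × ι) (ι × ι) k :=
    ((Matrix.kroneckerAlgEquiv ι ι k).toAlgHom.comp (Algebra.TensorProduct.map ρ ρ)).comp
      (Bialgebra.comulAlgHom k (Loc D))
  have hK : ∀ (b : Loc D) (p q i j : ι), K b (p, q) (i, j) =
      (toConv (Matrix.entryLinearMap k k p i ∘ₗ ρ.toLinearMap) *
          toConv (Matrix.entryLinearMap k k q j ∘ₗ ρ.toLinearMap)).ofConv b := by
    intro b p q i j
    rw [LinearMap.convMul_apply]
    simp only [K, AlgHom.comp_apply, Bialgebra.comulAlgHom_apply]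
    induction (Coalgebra.comul (R := k) b) using TensorProduct.induction_on with
    | zero => simp
    | tmul x y => simp
    | add x y hx hy => simp only [map_add, Matrix.add_apply, hx, hy]
  have hKof : ∀ a, K (Loc.of D a) = FRT.rhoKron hC (Coalgebra.comul a) := by
    intro a
    simp only [K, AlgHom.comp_apply, Bialgebra.comulAlgHom_apply, Loc.comul_of, FRT.rhoKron]
    congr 1
    induction (Coalgebra.comul (R := k) a) using TensorProduct.induction_on with
    | zero => simp
    | tmul x y => simp [hρ]
    | add x y hx hy => simp only [map_add, hx, hy]
  ext b
  have h := Loc.intertwine (α := K) (β := K)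
    (z := (Matrix.of fun x y => C y.1 y.2 x.1 x.2 : Matrix (ι × ι) (ι × ι) k))
    (fun i j => by
      rw [hKof]
      exact ((Subalgebra.mem_centralizer_iff k).1 (FRT.rhoKron_comm hC _) _ rfl).symm) b
  have h1 := congrFun (congrFun h (r, s)) (i, j)
  simp only [Matrix.mul_apply, Matrix.of_apply, Fintype.sum_prod_type, hK] at h1
  simp only [WithConv.ofConv_sum, WithConv.ofConv_smul, LinearMap.sum_apply,
    LinearMap.smul_apply, smul_eq_mul]
  rw [← Finset.sum_congr rfl fun p _ => Finset.sum_congr rfl fun q _ => mul_comm _ _, h1]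

/-- The map `a ↦ r(a, -)` on the localization. -/
theorem Loc.exists_formHom (hC : BraidEq C) {σ ρ : Loc D →ₐ[k] Matrix ι ι k}
    (hρ : ∀ a, ρ (Loc.of D a) = FRT.rho hC a)
    (hσρ : IsConvInv σ ((Matrix.transposeAlgEquiv ι k k).toAlgHom.comp ρ)) :
    ∃ (F : Loc D →ₐ[k] WithConv (Loc D →ₗ[k] k)) (G : Loc D →ₐ[k] (WithConv (Loc D →ₗ[k] k))ᵐᵒᵖ),
      IsConvInv F G ∧ ∀ i p, F (Loc.of D (FRT.t C i p)) =
        toConv (Matrix.entryLinearMap k k p i ∘ₗ ρ.toLinearMap) := by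
  let f : FRT C →ₐ[k] WithConv (Loc D →ₗ[k] k) :=
    FRT.lift C (fun i p => toConv (Matrix.entryLinearMap k k p i ∘ₗ ρ.toLinearMap))
      (Loc.rho_rel hC hρ)
  -- A matrix product of functionals is the convolution product of the matrix-valued maps. Hence the
  -- convolution inverse `σ` of the transpose of `ρ` inverts the matrix of functionals `f (tᵢᵖ)`.
  have key : ∀ (f g : Loc D →ₗ[k] Matrix ι ι k) (i j : ι) (b : Loc D),
      (∑ m, toConv (Matrix.entryLinearMap k k i m ∘ₗ f) *
        toConv (Matrix.entryLinearMap k k m j ∘ₗ g)).ofConv b =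
        (toConv f * toConv g).ofConv b i j := by
    intro f g i j b
    simp only [WithConv.ofConv_sum, LinearMap.sum_apply, LinearMap.convMul_apply]
    induction (Coalgebra.comul (R := k) b) using TensorProduct.induction_on with
    | zero => simp
    | tmul x y => simp [Matrix.mul_apply]
    | add x y hx hy => simp only [map_add, Matrix.add_apply, Finset.sum_add_distrib, hx, hy]
  have htr : ∀ i p, Matrix.entryLinearMap k k p i ∘ₗ ρ.toLinearMap =
      Matrix.entryLinearMap k k i p ∘ₗ
        unopLin ((Matrix.transposeAlgEquiv ι k k).toAlgHom.comp ρ) := by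
    intro i p
    ext b
    simp [Matrix.transposeAlgEquiv]
  have hone : ∀ (i j : ι) (b : Loc D),
      (1 : WithConv (Loc D →ₗ[k] Matrix ι ι k)).ofConv b i j =
        (if i = j then (1 : WithConv (Loc D →ₗ[k] k)) else 0).ofConv b := by
    intro i j b
    by_cases hij : i = j <;> simp [hij, Matrix.algebraMap_matrix_apply]
  obtain ⟨g, hfg, -⟩ := FRT.exists_isConvInv f
    (fun i p => toConv (Matrix.entryLinearMap k k i p ∘ₗ σ.toLinearMap))
    (fun i j => by
      ext b
      simp only [f, FRT.lift_t, htr]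
      rw [key, hσρ.eq_one_mul, hone])
    (fun i j => by
      ext b
      simp only [f, FRT.lift_t, htr]
      rw [key, hσρ.mul_eq_one, hone])
  obtain ⟨F, G, hFG, hF, -, -⟩ := Loc.exists_isConvInv D hfg
  exact ⟨F, G, hFG, fun i p => by rw [hF, FRT.lift_t]⟩

end Matrices

/-! ### Bilinear forms as maps to the convolution dual -/

section Pairing

open WithConv

variable {k : Type u} [Field k]

/-- The bilinear form of a map to the dual. -/
def bilin {X Y : Type*} [AddCommGroup X] [Module k X] [AddCommGroup Y] [Module k Y]
    (f : X →ₗ[k] WithConv (Y →ₗ[k] k)) : X →ₗ[k] Y →ₗ[k] k :=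
  (WithConv.linearEquiv k (Y →ₗ[k] k)).toLinearMap ∘ₗ f

@[simp]
theorem bilin_apply {X Y : Type*} [AddCommGroup X] [Module k X] [AddCommGroup Y] [Module k Y]
    (f : X →ₗ[k] WithConv (Y →ₗ[k] k)) (a : X) (b : Y) : bilin f a b = (f a).ofConv b := rfl

/-- Currying respects convolution, so a convolution inverse of `a ↦ r(a, -)` yields one of the
bilinear form `r`. -/
theorem lift_bilin_mul {X Y : Type*} [AddCommGroup X] [Module k X] [Coalgebra k X]
    [AddCommGroup Y] [Module k Y] [Coalgebra k Y] (f g : WithConv (X →ₗ[k] WithConv (Y →ₗ[k] k))) :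
    toConv (TensorProduct.lift (bilin (f * g).ofConv)) =
      toConv (TensorProduct.lift (bilin f.ofConv)) *
        toConv (TensorProduct.lift (bilin g.ofConv)) := by
  apply WithConv.ext
  apply TensorProduct.ext'
  intro a b
  rw [LinearMap.convMul_apply]
  simp only [TensorProduct.lift.tmul, bilin_apply, TensorProduct.comul_tmul,
    LinearMap.convMul_apply]
  induction (Coalgebra.comul (R := k) a) using TensorProduct.induction_on with
  | zero => simp
  | add x y hx hy =>
    simp only [map_add, TensorProduct.add_tmul, WithConv.ofConv_add, LinearMap.add_apply, hx, hy]
  | tmul x y =>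
    simp only [TensorProduct.map_tmul, LinearMap.mul'_apply, LinearMap.convMul_apply]
    induction (Coalgebra.comul (R := k) b) using TensorProduct.induction_on with
    | zero => simp
    | add x y hx hy => simp only [map_add, TensorProduct.tmul_add, hx, hy]
    | tmul x' y' => simp

theorem lift_bilin_one {X Y : Type*} [AddCommGroup X] [Module k X] [Coalgebra k X]
    [AddCommGroup Y] [Module k Y] [Coalgebra k Y] :
    toConv (TensorProduct.lift (bilin (1 : WithConv (X →ₗ[k] WithConv (Y →ₗ[k] k))).ofConv)) =
      1 := by
  apply WithConv.ext
  apply TensorProduct.ext'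
  intro a b
  simp [mul_comm]

/-- The tensor product of two elements of the dual algebras, in the reverse order. -/
def dualTensor (k : Type u) [Field k] (X : Type*) [Ring X] [Bialgebra k X] :
    WithConv (X →ₗ[k] k) ⊗[k] WithConv (X →ₗ[k] k) →ₐ[k] WithConv (X ⊗[k] X →ₗ[k] k) :=
  Algebra.TensorProduct.algHomOfLinearMapTensorProduct
    (TensorProduct.lift (LinearMap.mk₂ k
      (fun φ ψ => toConv (LinearMap.mul' k k ∘ₗ TensorProduct.map ψ.ofConv φ.ofConv))
      (fun φ φ' ψ => by ext; simp [mul_add])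
      (fun c φ ψ => by ext; simp; ring)
      (fun φ ψ ψ' => by ext; simp [add_mul])
      (fun c φ ψ => by ext; simp; ring)))
    (by
      intro φ φ' ψ ψ'
      apply WithConv.ext
      apply TensorProduct.ext'
      intro a b
      simp only [TensorProduct.lift.tmul, LinearMap.mk₂_apply, LinearMap.convMul_apply,
        TensorProduct.comul_tmul, LinearMap.comp_apply, TensorProduct.map_tmul,
        LinearMap.mul'_apply]
      induction (Coalgebra.comul (R := k) a) using TensorProduct.induction_on with
      | zero => simp
      | add x y hx hy => simp only [map_add, TensorProduct.add_tmul, add_mul, hx, hy]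
      | tmul x y =>
        induction (Coalgebra.comul (R := k) b) using TensorProduct.induction_on with
        | zero => simp
        | add x y hx hy => simp only [map_add, TensorProduct.tmul_add, mul_add, hx, hy]
        | tmul x' y' => simp; ring)
    (by
      apply WithConv.ext
      apply TensorProduct.ext'
      intro a b
      simp [mul_comm])

@[simp]
theorem dualTensor_tmul {X : Type*} [Ring X] [Bialgebra k X] (φ ψ : WithConv (X →ₗ[k] k))
    (a b : X) : (dualTensor k X (φ ⊗ₜ ψ)).ofConv (a ⊗ₜ b) = ψ.ofConv a * φ.ofConv b := rfl

/-- The map `φ ⊗ e ↦ (b ↦ φ(b) e)` to the convolution algebra. -/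
def dualSMul (k : Type u) [Field k] (X E : Type*) [Ring X] [Bialgebra k X] [Ring E] [Algebra k E] :
    WithConv (X →ₗ[k] k) ⊗[k] E →ₐ[k] WithConv (X →ₗ[k] E) :=
  Algebra.TensorProduct.algHomOfLinearMapTensorProduct
    (TensorProduct.lift (LinearMap.mk₂ k
      (fun φ e => toConv (φ.ofConv.smulRight e))
      (fun φ φ' ψ => by ext; simp [add_smul])
      (fun c φ ψ => by ext; simp [mul_smul])
      (fun φ ψ ψ' => by ext; simp)
      (fun c φ ψ => by ext; simp [smul_smul, mul_comm])))
    (by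
      intro φ φ' e e'
      ext a
      simp only [TensorProduct.lift.tmul, LinearMap.mk₂_apply, LinearMap.convMul_apply,
        LinearMap.smulRight_apply]
      induction (Coalgebra.comul (R := k) a) using TensorProduct.induction_on with
      | zero => simp
      | add x y hx hy => simp only [map_add, add_smul, hx, hy]
      | tmul x y => simp [smul_smul, mul_comm])
    (by
      ext a
      simp [Algebra.algebraMap_eq_smul_one])

@[simp]
theorem dualSMul_tmul {X E : Type*} [Ring X] [Bialgebra k X] [Ring E] [Algebra k E]
    (φ : WithConv (X →ₗ[k] k)) (e : E) (a : X) :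
    (dualSMul k X E (φ ⊗ₜ e)).ofConv a = φ.ofConv a • e := rfl

theorem mul'_map_dualSMul_left {X : Type*} [Ring X] [Bialgebra k X] (φ : WithConv (X →ₗ[k] k))
    (e : X) (z : X ⊗[k] X) :
    LinearMap.mul' k X (TensorProduct.map (dualSMul k X X (φ ⊗ₜ e)).ofConv LinearMap.id z) =
      e * LinearMap.mul' k X (TensorProduct.map (Algebra.linearMap k X ∘ₗ φ.ofConv)
        LinearMap.id z) := by
  induction z using TensorProduct.induction_on with
  | zero => simp
  | add x y hx hy => simp only [map_add, mul_add, hx, hy]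
  | tmul x y => simp [Algebra.smul_def, Algebra.left_comm, mul_assoc]

theorem mul'_map_dualSMul_right {X : Type*} [Ring X] [Bialgebra k X] (φ : WithConv (X →ₗ[k] k))
    (e : X) (z : X ⊗[k] X) :
    LinearMap.mul' k X (TensorProduct.map LinearMap.id (dualSMul k X X (φ ⊗ₜ e)).ofConv z) =
      LinearMap.mul' k X (TensorProduct.map LinearMap.id (Algebra.linearMap k X ∘ₗ φ.ofConv) z) *
        e := by
  induction z using TensorProduct.induction_on with
  | zero => simp
  | add x y hx hy => simp only [map_add, add_mul, hx, hy]
  | tmul x y => simp [Algebra.smul_def, mul_assoc]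

/-- Precomposition with a coalgebra map. -/
def dualComp {X Y : Type*} [AddCommGroup X] [Module k X] [Coalgebra k X]
    [AddCommGroup Y] [Module k Y] [Coalgebra k Y] (h : X →ₗc[k] Y) :
    WithConv (Y →ₗ[k] k) →ₐ[k] WithConv (X →ₗ[k] k) :=
  AlgHom.ofLinearMap
    ((WithConv.linearEquiv k (X →ₗ[k] k)).symm.toLinearMap ∘ₗ LinearMap.lcomp k k h.toLinearMap ∘ₗ
      (WithConv.linearEquiv k (Y →ₗ[k] k)).toLinearMap)
    (by ext; simp)
    (fun φ ψ => WithConv.ext (LinearMap.convMul_comp_coalgHom_distrib φ ψ h))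

@[simp]
theorem dualComp_apply {X Y : Type*} [AddCommGroup X] [Module k X] [Coalgebra k X]
    [AddCommGroup Y] [Module k Y] [Coalgebra k Y] (h : X →ₗc[k] Y) (φ : WithConv (Y →ₗ[k] k))
    (a : X) : (dualComp h φ).ofConv a = φ.ofConv (h a) := rfl

end Pairing

/-! ### The coquasitriangular structure of the localization -/

section Form

open WithConv

variable {k : Type u} {ι : Type w} [Field k] [Fintype ι] [DecidableEq ι]
  {C : ι → ι → ι → ι → k} {D : GroupLike k (FRT C)} {ρ : Loc D →ₐ[k] Matrix ι ι k}
  {F : Loc D →ₐ[k] WithConv (Loc D →ₗ[k] k)}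

/-- For fixed `b` and `d` neither side is multiplicative in `a`, but as functionals on the tensor
square both sides are algebra maps in `a`. They agree on the generators because `ρ` is
multiplicative. The reversal in `dualTensor` matches the order `r(a₂, b) r(a₁, d)`. -/
theorem Loc.bilin_mul_right (hF : ∀ i p, F (Loc.of D (FRT.t C i p)) =
      toConv (Matrix.entryLinearMap k k p i ∘ₗ ρ.toLinearMap)) (a b d : Loc D) :
    bilin F.toLinearMap a (b * d) = LinearMap.mul' k k (TensorProduct.map
      ((bilin F.toLinearMap).flip d) ((bilin F.toLinearMap).flip b) (Coalgebra.comul a)) := by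
  have h : (dualComp (Bialgebra.mulCoalgHom k (Loc D))).comp F =
      ((dualTensor k (Loc D)).comp (Algebra.TensorProduct.map F F)).comp
        (Bialgebra.comulAlgHom k (Loc D)) := by
    apply Loc.intertwine_eq
    intro i p
    apply WithConv.ext
    apply TensorProduct.ext'
    intro b d
    simp [hF, Matrix.mul_apply]
  have h1 := LinearMap.congr_fun (congrArg WithConv.ofConv (DFunLike.congr_fun h a)) (b ⊗ₜ d)
  have h2 : bilin F.toLinearMap a (b * d) = _ := h1
  rw [h2]
  simp only [AlgHom.comp_apply, Bialgebra.comulAlgHom_apply]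
  induction (Coalgebra.comul (R := k) a) using TensorProduct.induction_on with
  | zero => simp
  | add x y hx hy => simp only [map_add, WithConv.ofConv_add, LinearMap.add_apply, hx, hy]
  | tmul x y => simp [mul_comm]

/-- This is the commutation axiom for `a = tᵢᵖ` and arbitrary `b`. It says that the matrix of
generators intertwines two algebra maps in `b`, and for `b` a generator it is the FRT relation. -/
theorem Loc.bilin_comm_t (hC : BraidEq C) (hρ : ∀ a, ρ (Loc.of D a) = FRT.rho hC a)
    (i p : ι) (b : Loc D) :
    ∑ m, Loc.of D (FRT.t C m p) * LinearMap.mul' k (Loc D) (TensorProduct.map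
        (Algebra.linearMap k (Loc D) ∘ₗ Matrix.entryLinearMap k k m i ∘ₗ ρ.toLinearMap)
        LinearMap.id (Coalgebra.comul b)) =
      ∑ m, LinearMap.mul' k (Loc D) (TensorProduct.map LinearMap.id
        (Algebra.linearMap k (Loc D) ∘ₗ Matrix.entryLinearMap k k p m ∘ₗ ρ.toLinearMap)
        (Coalgebra.comul b)) * Loc.of D (FRT.t C i m) := by
  -- Here `θ'` is `b ↦ b₁ ρ(b₂)` and `θ` is `b ↦ ρ(b₁) b₂`, as matrices over the localization.
  let θ' : Loc D →ₐ[k] Matrix ι ι (Loc D) :=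
    ((matrixEquivTensor ι k (Loc D)).symm.toAlgHom.comp
      (Algebra.TensorProduct.map (AlgHom.id k _) ρ)).comp (Bialgebra.comulAlgHom k (Loc D))
  let θ : Loc D →ₐ[k] Matrix ι ι (Loc D) :=
    (((matrixEquivTensor ι k (Loc D)).symm.toAlgHom.comp
      (Algebra.TensorProduct.map (AlgHom.id k _) ρ)).comp
      (Algebra.TensorProduct.comm k (Loc D) (Loc D)).toAlgHom).comp
        (Bialgebra.comulAlgHom k (Loc D))
  have hθ' : ∀ b p q, θ' b p q = LinearMap.mul' k (Loc D) (TensorProduct.map LinearMap.id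
        (Algebra.linearMap k (Loc D) ∘ₗ Matrix.entryLinearMap k k p q ∘ₗ ρ.toLinearMap)
        (Coalgebra.comul b)) := by
    intro b p q
    simp only [θ', AlgHom.comp_apply, Bialgebra.comulAlgHom_apply]
    induction (Coalgebra.comul (R := k) b) using TensorProduct.induction_on with
    | zero => simp
    | add x y hx hy => simp only [map_add, Matrix.add_apply, hx, hy]
    | tmul x y => simp
  have hθ : ∀ b p q, θ b p q = LinearMap.mul' k (Loc D) (TensorProduct.map
        (Algebra.linearMap k (Loc D) ∘ₗ Matrix.entryLinearMap k k p q ∘ₗ ρ.toLinearMap)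
        LinearMap.id (Coalgebra.comul b)) := by
    intro b p q
    simp only [θ, AlgHom.comp_apply, Bialgebra.comulAlgHom_apply]
    induction (Coalgebra.comul (R := k) b) using TensorProduct.induction_on with
    | zero => simp
    | add x y hx hy => simp only [map_add, Matrix.add_apply, hx, hy]
    | tmul x y => simp [Algebra.commutes]
  have h := Loc.intertwine (α := θ') (β := θ)
    (z := Matrix.of fun p m => Loc.of D (FRT.t C m p)) (fun j l => by
      ext p i
      simp only [Matrix.mul_apply, hθ, hθ', Matrix.of_apply]
      have h := congrArg (Loc.of D) (FRT.rel C j i p l)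
      simp only [map_sum, map_smul, map_mul] at h
      simp only [Loc.comul_of_t, map_sum, TensorProduct.map_tmul, LinearMap.mul'_apply,
        LinearMap.id_apply, LinearMap.comp_apply, AlgHom.toLinearMap_apply, hρ, FRT.rho,
        FRT.lift_t, Matrix.entryLinearMap_apply, Matrix.of_apply, Algebra.linearMap_apply,
        Finset.mul_sum, Finset.sum_mul]
      rw [Finset.sum_comm]
      simpa [Algebra.smul_def, ← Algebra.commutes (R := k), mul_assoc, Algebra.left_comm] using h.symm) b
  have h1 := congrFun (congrFun h p) i
  simp only [Matrix.mul_apply, hθ, hθ', Matrix.of_apply] at h1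
  exact h1.symm

theorem Loc.isCoquasitriangular (hC : BraidEq C) (hρ : ∀ a, ρ (Loc.of D a) = FRT.rho hC a)
    {G : Loc D →ₐ[k] (WithConv (Loc D →ₗ[k] k))ᵐᵒᵖ} (hFG : IsConvInv F G)
    (hF : ∀ i p, F (Loc.of D (FRT.t C i p)) =
      toConv (Matrix.entryLinearMap k k p i ∘ₗ ρ.toLinearMap)) :
    IsCoquasitriangular (bilin F.toLinearMap) where
  isUnit := by
    have h1 := lift_bilin_mul (toConv F.toLinearMap) (toConv (unopLin G))
    have h2 := lift_bilin_mul (toConv (unopLin G)) (toConv F.toLinearMap)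
    rw [hFG.mul_eq_one, lift_bilin_one] at h1
    rw [hFG.eq_one_mul, lift_bilin_one] at h2
    exact ⟨⟨_, _, h1.symm, h2.symm⟩, rfl⟩
  mul_left a b d := by simp [LinearMap.convMul_apply]; rfl
  mul_right := Loc.bilin_mul_right hF
  comm := by
    -- With `α(a) = r(a₁, -) a₂` and `β(a) = r(a₂, -) a₁`, the axiom says that the identity map
    -- intertwines `α` and `β` under convolution. This reduces `a` to a generator, the case settled
    -- by `Loc.bilin_comm_t`.
    let α : Loc D →ₐ[k] WithConv (Loc D →ₗ[k] Loc D) :=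
      ((dualSMul k (Loc D) (Loc D)).comp (Algebra.TensorProduct.map F (AlgHom.id k _))).comp
        (Bialgebra.comulAlgHom k (Loc D))
    let β : Loc D →ₐ[k] WithConv (Loc D →ₗ[k] Loc D) :=
      (((dualSMul k (Loc D) (Loc D)).comp (Algebra.TensorProduct.map F (AlgHom.id k _))).comp
        (Algebra.TensorProduct.comm k (Loc D) (Loc D)).toAlgHom).comp
          (Bialgebra.comulAlgHom k (Loc D))
    have h := Loc.intertwine (α := α) (β := β) (z := toConv LinearMap.id) (fun i p => by
      ext b
      have h := Loc.bilin_comm_t hC hρ i p b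
      simp only [α, β, AlgHom.comp_apply, Bialgebra.comulAlgHom_apply, Loc.comul_of_t, map_sum,
        AlgEquiv.coe_toAlgHom, Algebra.TensorProduct.comm_tmul,
        Algebra.TensorProduct.map_tmul, hF, AlgHom.coe_id, id_eq, Finset.sum_mul, Finset.mul_sum,
        WithConv.ofConv_sum, LinearMap.sum_apply, LinearMap.convMul_apply]
      exact (Finset.sum_congr rfl fun m _ => mul'_map_dualSMul_left _ _ _).trans
        (h.trans (Finset.sum_congr rfl fun m _ => (mul'_map_dualSMul_right _ _ _).symm)))
    apply WithConv.ext
    apply TensorProduct.ext'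
    intro a b
    have h1 := LinearMap.congr_fun (congrArg WithConv.ofConv (h a)) b
    simp only [LinearMap.convMul_apply, α, β, AlgHom.comp_apply,
      Bialgebra.comulAlgHom_apply] at h1
    simp only [LinearMap.convMul_apply, TensorProduct.comul_tmul]
    refine Eq.trans ?_ (h1.trans ?_)
    · clear h1
      induction (Coalgebra.comul (R := k) a) using TensorProduct.induction_on with
      | zero => simp
      | add x y hx hy =>
        simp only [map_add, TensorProduct.add_tmul, WithConv.ofConv_add, TensorProduct.map_add_left,
          LinearMap.add_apply, hx, hy]
      | tmul x y =>
        induction (Coalgebra.comul (R := k) b) using TensorProduct.induction_on with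
        | zero => simp
        | add x y hx hy => simp only [map_add, TensorProduct.tmul_add, hx, hy]
        | tmul x' y' => simp [Algebra.smul_def, mul_assoc]
    · clear h1
      induction (Coalgebra.comul (R := k) a) using TensorProduct.induction_on with
      | zero => simp
      | add x y hx hy =>
        simp only [map_add, TensorProduct.add_tmul, WithConv.ofConv_add,
          TensorProduct.map_add_right, LinearMap.add_apply, hx, hy]
      | tmul x y =>
        induction (Coalgebra.comul (R := k) b) using TensorProduct.induction_on with
        | zero => simp
        | add x y hx hy => simp only [map_add, TensorProduct.tmul_add, hx, hy]
        | tmul x' y' => simp [Algebra.smul_def, ← Algebra.commutes (R := k), Algebra.left_comm]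

end Form

/-! ### Hayashi's map is conjugation by the group-like element -/

section Hayashi

open WithConv

variable {k : Type u} {ι : Type w} [Field k] [Fintype ι] [DecidableEq ι]
  {C : ι → ι → ι → ι → k} {D : GroupLike k (FRT C)} {ρ : Loc D →ₐ[k] Matrix ι ι k}
  {F : Loc D →ₐ[k] WithConv (Loc D →ₗ[k] k)} {G : Loc D →ₐ[k] (WithConv (Loc D →ₗ[k] k))ᵐᵒᵖ}

theorem FRT.form_eq (hC : BraidEq C) (hρ : ∀ a, ρ (Loc.of D a) = FRT.rho hC a)
    (hF : ∀ i p, F (Loc.of D (FRT.t C i p)) =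
      toConv (Matrix.entryLinearMap k k p i ∘ₗ ρ.toLinearMap)) (a b : FRT C) :
    FRT.form hC a b = bilin F.toLinearMap (Loc.of D a) (Loc.of D b) := by
  have h : FRT.formHom hC = (dualComp (Loc.ofCoalgHom D)).comp (F.comp (Loc.of D)) := by
    apply FRT.hom_ext
    intro i p
    ext b
    simp [FRT.formHom, hF, hρ, FRT.tForm_apply]
  exact LinearMap.congr_fun (congrArg WithConv.ofConv (DFunLike.congr_fun h a)) b

theorem FRT.convInv_form (hC : BraidEq C) (hρ : ∀ a, ρ (Loc.of D a) = FRT.rho hC a)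
    (hF : ∀ i p, F (Loc.of D (FRT.t C i p)) =
      toConv (Matrix.entryLinearMap k k p i ∘ₗ ρ.toLinearMap)) (hFG : IsConvInv F G)
    (a b : FRT C) :
    convInv (FRT.form hC) a b = bilin (unopLin G) (Loc.of D a) (Loc.of D b) := by
  let h : FRT C ⊗[k] FRT C →ₗc[k] Loc D ⊗[k] Loc D :=
    Coalgebra.TensorProduct.map (Loc.ofCoalgHom D) (Loc.ofCoalgHom D)
  have h1 := lift_bilin_mul (toConv F.toLinearMap) (toConv (unopLin G))
  have h2 := lift_bilin_mul (toConv (unopLin G)) (toConv F.toLinearMap)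
  rw [hFG.mul_eq_one, lift_bilin_one] at h1
  rw [hFG.eq_one_mul, lift_bilin_one] at h2
  have h3 := congrArg (dualComp h) h1
  have h4 := congrArg (dualComp h) h2
  rw [map_one, map_mul] at h3 h4
  have hform : toConv (TensorProduct.lift (FRT.form hC)) =
      dualComp h (toConv (TensorProduct.lift (bilin F.toLinearMap))) := by
    apply WithConv.ext
    apply TensorProduct.ext'
    intro a b
    exact FRT.form_eq hC hρ hF a b
  -- `Ring.inverse` is zero off the units, so a unit must be exhibited. Restriction along a
  -- coalgebra map is an algebra map of duals, so the restrictions of the two inverse forms are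
  -- inverse to each other.
  have hinv := Ring.inverse_unit (Units.mk _ _ h3.symm h4.symm)
  rw [Units.val_mk, Units.inv_mk] at hinv
  rw [convInv, hform]
  exact LinearMap.congr_fun (congrArg WithConv.ofConv hinv) (a ⊗ₜ b)

/-- With `χ = r(-, D)`, the commutation axiom at the group-like `D` reads `(χ * o) D = D (o * χ)` in
the convolution algebra. Convolving on the right with `χ⁻¹` turns the left side into Hayashi's map
times `D` and the right side into `D` times the inclusion. -/
theorem Loc.of_hayashi_mul (hC : BraidEq C) (hρ : ∀ a, ρ (Loc.of D a) = FRT.rho hC a)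
    (hF : ∀ i p, F (Loc.of D (FRT.t C i p)) =
      toConv (Matrix.entryLinearMap k k p i ∘ₗ ρ.toLinearMap)) (hFG : IsConvInv F G)
    (a : FRT C) :
    Loc.of D (hayashi (FRT.form hC) D a) * Loc.of D D = Loc.of D D * Loc.of D a := by
  let φ : FRT C →ₗ[k] k := (FRT.form hC).flip D
  let ψ : FRT C →ₗ[k] k := (convInv (FRT.form hC)).flip D
  let χ : WithConv (FRT C →ₗ[k] Loc D) := toConv (Algebra.linearMap k (Loc D) ∘ₗ φ)
  let χ' : WithConv (FRT C →ₗ[k] Loc D) := toConv (Algebra.linearMap k (Loc D) ∘ₗ ψ)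
  let o : WithConv (FRT C →ₗ[k] Loc D) := toConv (Loc.of D).toLinearMap
  have hχ : χ * χ' = 1 := by
    ext a
    have h := congrArg (fun z => z.ofConv (Loc.of D D))
      (LinearMap.congr_fun (congrArg WithConv.ofConv hFG.mul_eq_one) (Loc.of D a))
    simp only [LinearMap.convMul_apply, LinearMap.convOne_apply, Loc.comul_of] at h
    simp only [LinearMap.convMul_apply, LinearMap.convOne_apply]
    have h' : (algebraMap k (WithConv (Loc D →ₗ[k] k)) (Coalgebra.counit (R := k)
        (Loc.of D a))).ofConv (Loc.of D D) = Coalgebra.counit (R := k) a := by simp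
    rw [← h', ← h]
    clear h h'
    induction (Coalgebra.comul (R := k) a) using TensorProduct.induction_on with
    | zero => simp
    | add x y hx hy => simp only [map_add, WithConv.ofConv_add, LinearMap.add_apply, hx, hy]
    | tmul x y =>
      simp [χ, χ', φ, ψ, FRT.form_eq hC hρ hF, FRT.convInv_form hC hρ hF hFG, Loc.comul_of]
  have hcomm : LinearMap.mulRight k (Loc.of D D) ∘ₗ (χ * o).ofConv =
      LinearMap.mulLeft k (Loc.of D D) ∘ₗ (o * χ).ofConv := by
    ext a
    have h := LinearMap.congr_fun (congrArg WithConv.ofConv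
      (Loc.isCoquasitriangular hC hρ hFG hF).comm) (Loc.of D a ⊗ₜ Loc.of D D)
    simp only [LinearMap.convMul_apply, TensorProduct.comul_tmul, Loc.comul_of,
      D.isGroupLikeElem_val.comul_eq_tmul_self, TensorProduct.map_tmul] at h
    simp only [LinearMap.comp_apply, LinearMap.convMul_apply]
    refine Eq.trans ?_ (h.trans ?_)
    · clear h
      induction (Coalgebra.comul (R := k) a) using TensorProduct.induction_on with
      | zero => simp
      | add x y hx hy => simp only [map_add, TensorProduct.add_tmul, hx, hy]
      | tmul x y => simp [χ, φ, o, FRT.form_eq hC hρ hF, mul_assoc]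
    · clear h
      induction (Coalgebra.comul (R := k) a) using TensorProduct.induction_on with
      | zero => simp
      | add x y hx hy => simp only [map_add, TensorProduct.add_tmul, hx, hy]
      | tmul x y => simp [χ, φ, o, FRT.form_eq hC hρ hF, mul_assoc]
  -- Multiplication by `D` passes through convolution with `χ'` because the values of `χ'` are
  -- scalars.
  have hright : LinearMap.mulRight k (Loc.of D D) ∘ₗ (χ * o * χ').ofConv =
      (toConv (LinearMap.mulRight k (Loc.of D D) ∘ₗ (χ * o).ofConv) * χ').ofConv := by
    ext a
    simp only [LinearMap.comp_apply, LinearMap.convMul_apply _ χ']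
    induction (Coalgebra.comul (R := k) a) using TensorProduct.induction_on with
    | zero => simp
    | add x y hx hy => simp only [map_add, hx, hy]
    | tmul x y => simp [χ', mul_assoc, Algebra.commutes]
  have hleft : LinearMap.mulLeft k (Loc.of D D) ∘ₗ (o * χ * χ').ofConv =
      (toConv (LinearMap.mulLeft k (Loc.of D D) ∘ₗ (o * χ).ofConv) * χ').ofConv := by
    ext a
    simp only [LinearMap.comp_apply, LinearMap.convMul_apply _ χ']
    induction (Coalgebra.comul (R := k) a) using TensorProduct.induction_on with
    | zero => simp
    | add x y hx hy => simp only [map_add, hx, hy]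
    | tmul x y => simp [mul_assoc]
  have hhay : Loc.of D (hayashi (FRT.form hC) D a) = (χ * o * χ').ofConv a := by
    rw [mul_assoc, LinearMap.convMul_apply]
    simp only [hayashi, LinearMap.comp_apply]
    induction (Coalgebra.comul (R := k) a) using TensorProduct.induction_on with
    | zero => simp
    | add x y hx hy => simp only [map_add, hx, hy]
    | tmul x y =>
      simp only [LinearMap.lTensor_tmul, TensorProduct.map_tmul, LinearMap.mul'_apply,
        LinearMap.convMul_apply, LinearEquiv.coe_coe, TensorProduct.lid_tmul, map_smul,
        LinearMap.comp_apply]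
      rw [Algebra.smul_def]
      congr 1
      induction (Coalgebra.comul (R := k) y) using TensorProduct.induction_on with
      | zero => simp
      | add x y hx hy => simp only [map_add, hx, hy]
      | tmul x y => simp [o, χ', ψ, Algebra.smul_def, Algebra.commutes]
  rw [hcomm, ← hleft, mul_assoc o, hχ, mul_one] at hright
  rw [hhay]
  exact LinearMap.congr_fun hright a

end Hayashi

/-! ### Expansion of the quantum determinant -/

section Cofactor

open WithConv

variable {k V ι B : Type*} [Field k] [AddCommGroup V] [Module k V]
    [Fintype ι] [DecidableEq ι] {C : ι → ι → ι → ι → k} {x : Module.Basis ι k V}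
    [Ring B] [Algebra k B] {𝓑 : ℕ → Submodule k B} [GradedAlgebra 𝓑]
    (W : WGFAlgebra (FRT.coaction C x) 𝓑)

/-- The expansion `∑ m, tᵢᵐ Tₘʲ = δᵢʲ D` of the quantum determinant. -/
theorem WGFAlgebra.sum_t_mul_cofactor {b : B} (hb : b ∈ 𝓑 W.top) (hb0 : b ≠ 0) (i j : ι) :
    ∑ m, FRT.t C i m * W.cofactor x hb hb0 m j = if i = j then W.det.val else 0 := by
  -- Elements of `FRT C` are compared as coefficients of the nonzero volume element `b`.
  apply WGFAlgebra.tmul_right_injective (k := k) hb0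
  have hδ : FRT.coaction C x (x i) = ∑ j, FRT.t C i j ⊗ₜ[k] x j := x.constr_basis k _ i
  have h := congrArg W.coact (W.mul_dualBasis x hb hb0 i j)
  rw [map_mul, W.coact_equiv, W.coact_dualBasis, hδ,
    apply_ite W.coact, map_zero, W.coact_top hb] at h
  simp only [map_sum, LinearMap.lTensor_tmul, LinearMap.comp_apply, LinearEquiv.coe_coe,
    Submodule.subtype_apply, Finset.sum_mul_sum, Algebra.TensorProduct.tmul_mul_tmul,
    W.mul_dualBasis, TensorProduct.tmul_ite, Finset.sum_ite_eq,
    Finset.mem_univ, if_true] at h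
  simp only [TensorProduct.sum_tmul, TensorProduct.ite_tmul]
  exact h

end Cofactor

/-! ### The antipode from an inverse of the generator matrix -/

section Antipode

open WithConv

variable {k ι : Type*} [Field k] [Fintype ι] [DecidableEq ι]
  {C : ι → ι → ι → ι → k} (D : GroupLike k (FRT C))

/-- If the matrix of the `tᵢʲ` is invertible over the localization, then the localization is a
Hopf algebra. -/
theorem Loc.exists_hopfAlgebra (s : ι → ι → Loc D)
    (hts : ∀ i j, ∑ m, Loc.of D (FRT.t C i m) * s m j = if i = j then 1 else 0)
    (hst : ∀ i j, ∑ m, s i m * Loc.of D (FRT.t C m j) = if i = j then 1 else 0) :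
    ∃ S : HopfAlgebra k (Loc D), S.toBialgebra = Loc.instBialgebra D ∧
      S.antipode (Loc.inv D) = Loc.of D D ∧
      ∀ i j, S.antipode (Loc.of D (FRT.t C i j)) = s i j := by
  obtain ⟨g, hg, hgt⟩ := FRT.exists_isConvInv (Loc.of D) s hts hst
  -- Since `F` extends `Loc.of` it is the identity, so `hFG` is exactly the antipode axiom for `G`.
  obtain ⟨F, G, hFG, hF, hG, hGinv⟩ := Loc.exists_isConvInv D hg
  obtain rfl : F = AlgHom.id k (Loc D) := Loc.intertwine_eq fun i j => hF _
  refine ⟨{ Loc.instBialgebra D with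
    antipode := unopLin G
    mul_antipode_rTensor_comul := congrArg WithConv.ofConv hFG.eq_one_mul
    mul_antipode_lTensor_comul := congrArg WithConv.ofConv hFG.mul_eq_one }, rfl, ?_, ?_⟩
  · exact congrArg MulOpposite.unop hGinv
  · exact fun i j => congrArg MulOpposite.unop ((hG _).trans (hgt i j))

end Antipode

end QDet

end

theorem mainTheorem2 {k V ι B : Type*} [Field k] [AddCommGroup V] [Module k V]
    [Fintype ι] [DecidableEq ι] (x : Module.Basis ι k V)
    (c : V ⊗[k] V ≃ₗ[k] V ⊗[k] V) (hc : QDet.IsBraiding c) (hrigid : QDet.IsRigid x c)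
    [Ring B] [Algebra k B] (𝓑 : ℕ → Submodule k B) [GradedAlgebra 𝓑]
    (W : QDet.WGFAlgebra (QDet.FRT.coaction (QDet.braidCoeff x c) x) 𝓑)
    (b : B) (hb : b ∈ 𝓑 W.top) (hb0 : b ≠ 0)
    (h : ∀ i j : ι,
      ∑ m, QDet.hayashi (QDet.FRT.form hc.coeff) W.det.val (W.cofactor x hb hb0 i m) *
        QDet.FRT.t (QDet.braidCoeff x c) m j = if i = j then W.det.val else 0) :
    (∃ r : QDet.Loc W.det →ₗ[k] QDet.Loc W.det →ₗ[k] k, QDet.IsCoquasitriangular r) ∧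
      ∃ S : HopfAlgebra k (QDet.Loc W.det),
        S.toBialgebra = QDet.Loc.instBialgebra W.det ∧
        S.antipode (QDet.Loc.inv W.det) = QDet.Loc.of W.det W.det.val ∧
        ∀ i j : ι,
          S.antipode (QDet.Loc.of W.det (QDet.FRT.t (QDet.braidCoeff x c) i j)) =
            QDet.Loc.of W.det (W.cofactor x hb hb0 i j) * QDet.Loc.inv W.det := by
  obtain ⟨σ, ρ, hρ, hσρ⟩ := QDet.Loc.exists_rho W.det hc.coeff (QDet.braidCoeff_mul_symm x c)
    (QDet.braidCoeff_mul_symm x c.symm)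
  obtain ⟨F, G, hFG, hF⟩ := QDet.Loc.exists_formHom hc.coeff hρ hσρ
  refine ⟨⟨_, QDet.Loc.isCoquasitriangular hc.coeff hρ hFG hF⟩, ?_⟩
  have hconj : ∀ a, QDet.Loc.of W.det
      (QDet.hayashi (QDet.FRT.form hc.coeff) W.det.val a) =
        QDet.Loc.of W.det W.det.val * QDet.Loc.of W.det a * QDet.Loc.inv W.det := by
    intro a
    rw [← QDet.Loc.of_hayashi_mul hc.coeff hρ hF hFG, mul_assoc, QDet.Loc.mul_inv, mul_one]
  refine QDet.Loc.exists_hopfAlgebra W.det _ (fun i j => ?_) (fun i j => ?_)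
  -- Right inverse: `t T = D`, multiplied on the right by `D⁻¹`.
  · have h1 := congrArg (fun a => QDet.Loc.of W.det a * QDet.Loc.inv W.det)
      (QDet.WGFAlgebra.sum_t_mul_cofactor W hb hb0 i j)
    simp only [map_sum, map_mul, Finset.sum_mul, mul_assoc] at h1
    rw [h1]
    by_cases hij : i = j <;> simp [hij, QDet.Loc.mul_inv]
  -- Left inverse: by `hconj` the hypothesis becomes `D T D⁻¹ t = D`, and `D` is cancelled on the
  -- left.
  · have h1 := congrArg (fun a => QDet.Loc.inv W.det * QDet.Loc.of W.det a) (h i j)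
    simp only [map_sum, map_mul, hconj, Finset.mul_sum, ← mul_assoc, QDet.Loc.inv_mul,
      one_mul] at h1
    rw [h1]
    by_cases hij : i = j <;> simp [hij, QDet.Loc.inv_mul]
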